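/- **Conventions.** For a graph $G$ let $\mu(G)$ be its maximum matching size. A subgraph $H$ of an $n$-vertex (multi)graph $G$ is an $\alpha$-matching cover of $G$ if $\mu(H[A,B]) \ge \mu(G[A,B]) - \alpha n$ for all disjoint vertex sets $A,B$. Space is measured in bits, as $\log_2$ of the number of states of the memory. $\log$ is binary, and a logarithm of the form $\log(n^2/x)$ in a bound is read as $1$ where it is below $1$. A subroutine accesses its input graph only by adjacency matrix queries, may flip coins, and writes its output edges one at a time. A single-pass streaming algorithm with access to a subroutine reads the edges of a multigraph one at a time, may call the subroutine on a graph held in its memory (answering the adjacency queries from memory), and its output is determined by its final memory state; its space includes that of the subroutine. It is a merge-and-reduce algorithm with $t$ buffers if its memory maintains edge sets $B_1,\dots,B_t$, initially empty, such that each (non-loop) edge read is inserted into $B_1$; each call runs the subroutine on some $B_i$ with $i<t$, inserts the returned edges into $B_{i+1}$ and then empties $B_i$, where a $B_{i+1}$ that already holds $2s$ edges ($s$ being the size bound of the subroutine below) may refuse further ones; the buffers change in no other way; and the output is $B_1\cup\dots\cup B_t$. **Proposition.** For every constant $c>0$ there is a constant $C>0$ such that the following holds for all $n, s\ge 0$,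 $1\le k\le m$ and $\alpha\in(0,1/10)$. There is a single-pass merge-and-reduce streaming algorithm $\mathcal A$ with at most $C(1+\log k)$ buffers (on streams of at most $m$ edges) such that the following holds for every subroutine $\mathsf{MatchingCover}$ and every $p\ge 0$. Suppose that the subroutine uses at most $c\cdot\frac mk\log\frac{n^2k}{m}$ space and that, on every $n$-vertex graph with at most $\max\{\lceil m/k\rceil, 2s\}$ edges, it outputs an $\frac{\alpha}{2k}$-matching cover with at most $s=\mathrm{MC}(n,\alpha/2k)$ edges except with probability at most $p$. Then $\mathcal A$ with this subroutine 1. uses space at most $C\left(\frac mk\log\frac{n^2k}{m} + s\,\log\frac{n^2}{s}\cdot\log k\right)$; 2. on every stream of at most $m$ edges forming an $n$-vertex multigraph $G$, in any order, outputs an $\alpha$-matching cover of $G$ with probability at least $1-Ckp$ (so with probability $1$ if $p=0$), and in every execution calls the subroutine at most $Ck$ times; 3. is deterministic if the subroutine is deterministic. -/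

import Mathlib

/-! ### Matchings and matching covers -/

/-- The maximum number of edges of a matching in `G`. -/
noncomputable def matchingNumber {V : Type} (G : SimpleGraph V) : ℕ :=
  sSup {r | ∃ M : G.Subgraph, M.IsMatching ∧ M.edgeSet.ncard = r}

/-- The edge set `F` is (the edge set of) an `α`-matching cover of the graph `G` on `n` vertices:
a subgraph that preserves the maximum matching size between any two disjoint vertex sets, up to
an additive `α * n`. -/
def IsMatchingCover {n : ℕ} (α : ℝ) (G : SimpleGraph (Fin n)) (F : Finset (Sym2 (Fin n))) :
    Prop :=
  (F : Set (Sym2 (Fin n))) ⊆ G.edgeSet ∧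
    ∀ A B : Set (Fin n), Disjoint A B →
      (matchingNumber (G.between A B) : ℝ) - α * n ≤
        matchingNumber ((SimpleGraph.fromEdgeSet (F : Set (Sym2 (Fin n)))).between A B)

/-- The simple graph underlying a multigraph that is given as the list of its edges. Parallel
edges and self-loops do not affect matchings between disjoint vertex sets. -/
def streamGraph {n : ℕ} (es : List (Sym2 (Fin n))) : SimpleGraph (Fin n) :=
  SimpleGraph.fromEdgeSet {e | e ∈ es}

/-! ### Randomized machines -/

/-- Run `T` steps of a machine with configurations `K` from configuration `c`. -/
noncomputable def runFor {K : Type} (step : K → PMF K) : ℕ → K → PMF K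
  | 0, c => PMF.pure c
  | T + 1, c => (step c).bind (runFor step T)

/-- Configurations that the machine can be in, with positive probability, after some number of
steps from `c`. -/
def Reachable {K : Type} (step : K → PMF K) (c c' : K) : Prop :=
  ∃ T, c' ∈ (runFor step T c).support

/-- The probability that the machine ever arrives in `E`, for a set `E` of halted
configurations (a halted machine stays where it is, so the supremum is an increasing limit). -/
noncomputable def haltProb {K : Type} (step : K → PMF K) (c : K) (E : Set K) : ENNReal :=
  ⨆ T, (runFor step T c).toOuterMeasure E

/-- A machine is deterministic if every step has only one possible outcome. -/
def IsDeterministic {K : Type} (step : K → PMF K) : Prop :=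
  ∀ c, ∃ c', step c = PMF.pure c'

/-- A fair coin flip. -/
noncomputable def coin {K : Type} (a b : K) : PMF K :=
  (PMF.uniformOfFintype Bool).map fun r => if r then a else b

/-! ### Offline subroutines with adjacency matrix access -/

/-- The instruction executed in a memory state: query one entry of the adjacency matrix, flip a
coin, write an edge to the write-only output, or halt. -/
inductive QueryOp (n : ℕ) (Q : Type) where
  | query (u v : Fin n) (no yes : Q)
  | flip (a b : Q)
  | emit (e : Sym2 (Fin n)) (next : Q)
  | halt

/-- A (possibly randomized) offline algorithm on `n`-vertex graphs, accessing its input graph by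
adjacency matrix queries only. `Q` is the set of states of its whole working memory. -/
structure Subroutine (n : ℕ) where
  Q : Type
  finiteQ : Finite Q
  start : Q
  op : Q → QueryOp n Q

namespace Subroutine

variable {n : ℕ}

/-- Space in bits. -/
noncomputable def space (S : Subroutine n) : ℝ := Real.logb 2 (Nat.card S.Q)

/-- A memory state together with the set of edges written so far. -/
structure Config (S : Subroutine n) where
  mem : S.Q
  out : Finset (Sym2 (Fin n))

open Classical in
/-- One step on the input graph `G`. -/
noncomputable def step (S : Subroutine n) (G : SimpleGraph (Fin n)) (c : S.Config) :
    PMF S.Config :=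
  match S.op c.mem with
  | .query u v no yes => PMF.pure ⟨if G.Adj u v then yes else no, c.out⟩
  | .flip a b => coin ⟨a, c.out⟩ ⟨b, c.out⟩
  | .emit e next => PMF.pure ⟨next, insert e c.out⟩
  | .halt => PMF.pure c

/-- On every `n`-vertex graph with at most `N` edges, the subroutine halts with a `δ`-matching
cover of at most `s` edges, except with probability at most `p`. -/
def ComputesCovers (S : Subroutine n) (N : ℕ) (δ : ℝ) (s : ℕ) (p : ℝ) : Prop :=
  ∀ G : SimpleGraph (Fin n), G.edgeSet.ncard ≤ N →
    ENNReal.ofReal (1 - p) ≤ haltProb (S.step G) ⟨S.start, ∅⟩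
      {c | S.op c.mem = .halt ∧ IsMatchingCover δ G c.out ∧ c.out.card ≤ s}

end Subroutine

/-! ### Single-pass streaming algorithms with access to a subroutine -/

/-- The instruction executed in a memory state: read the next edge of the stream (or learn that
there is none), flip a coin, call the subroutine, or halt with an output that is determined by the
memory state. -/
inductive StreamOp (n : ℕ) (M : Type) where
  | read (next : Sym2 (Fin n) → M) (endOfStream : M)
  | flip (a b : M)
  | call
  | halt (out : Finset (Sym2 (Fin n)))

/-- A single-pass streaming algorithm on `n` vertices that may call an offline subroutine.
`M` is the set of states of its memory (that of the subroutine excluded). While the subroutine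
runs, the algorithm answers its adjacency matrix queries from memory by `adj`, processes each edge
written by the subroutine by `recv`, and continues in the state given by `ret` when the subroutine
halts. -/
structure StreamAlg (n : ℕ) where
  M : Type
  finiteM : Finite M
  start : M
  op : M → StreamOp n M
  adj : M → Fin n → Fin n → Bool
  recv : M → Sym2 (Fin n) → M
  ret : M → M

namespace StreamAlg

variable {n : ℕ}

/-- The configuration of the algorithm running with subroutine `S`: the memory state, the memory
state of the subroutine if a call is in progress, the unread part of the stream and the number of
calls made so far (the last two are not part of the memory). -/
structure Config (A : StreamAlg n) (S : Subroutine n) where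
  mem : A.M
  sub : Option S.Q
  rest : List (Sym2 (Fin n))
  calls : ℕ

/-- Total space, in bits, of the algorithm running with the subroutine `S`. -/
noncomputable def space (A : StreamAlg n) (S : Subroutine n) : ℝ :=
  Real.logb 2 (Nat.card (A.M × Option S.Q))

def init (A : StreamAlg n) (S : Subroutine n) (es : List (Sym2 (Fin n))) : A.Config S :=
  ⟨A.start, none, es, 0⟩

noncomputable def step (A : StreamAlg n) (S : Subroutine n) (c : A.Config S) :
    PMF (A.Config S) :=
  match c.sub with
  | none =>
    match A.op c.mem with
    | .read next endOfStream =>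
      match c.rest with
      | [] => PMF.pure ⟨endOfStream, none, [], c.calls⟩
      | e :: es => PMF.pure ⟨next e, none, es, c.calls⟩
    | .flip a b => coin ⟨a, none, c.rest, c.calls⟩ ⟨b, none, c.rest, c.calls⟩
    | .call => PMF.pure ⟨c.mem, some S.start, c.rest, c.calls + 1⟩
    | .halt _ => PMF.pure c
  | some q =>
    match S.op q with
    | .query u v no yes =>
      PMF.pure ⟨c.mem, some (if A.adj c.mem u v then yes else no), c.rest, c.calls⟩
    | .flip a b => coin ⟨c.mem, some a, c.rest, c.calls⟩ ⟨c.mem, some b, c.rest, c.calls⟩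
    | .emit e q' => PMF.pure ⟨A.recv c.mem e, some q', c.rest, c.calls⟩
    | .halt => PMF.pure ⟨A.ret c.mem, none, c.rest, c.calls⟩

/-- The probability that the algorithm, run with subroutine `S` on the stream `es`, halts with an
`α`-matching cover of the streamed multigraph. -/
noncomputable def successProb (A : StreamAlg n) (S : Subroutine n) (es : List (Sym2 (Fin n)))
    (α : ℝ) : ENNReal :=
  haltProb (A.step S) (A.init S es)
    {c | c.sub = none ∧ ∃ F, A.op c.mem = .halt F ∧ IsMatchingCover α (streamGraph es) F}

/-- The algorithm is a merge-and-reduce algorithm with `t` buffers on streams of at most `m` edges.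
There is a view of its memory as edge buffers `0, ..., t - 1` (and a designated buffer `src`) such
that, in every execution with any subroutine:
all buffers are empty at the start; each edge read is added to buffer `0` (self-loops are ignored);
each call runs the subroutine on the graph formed by a buffer `i` and adds the returned edges to
buffer `i + 1` (only a buffer that already holds `2 * s` edges may refuse them), and empties
buffer `i` when the call ends; the buffers do not change otherwise; and the output is the union of
the buffers. -/
def IsMergeReduce (A : StreamAlg n) (m s t : ℕ) : Prop :=
  ∃ (buf : A.M → ℕ → Finset (Sym2 (Fin n))) (src : A.M → ℕ),
    0 < t ∧ (∀ i, buf A.start i = ∅) ∧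
    ∀ (S : Subroutine n) (es : List (Sym2 (Fin n))), es.length ≤ m →
      ∀ c : A.Config S, Reachable (A.step S) (A.init S es) c →
        match c.sub with
        | none =>
          match A.op c.mem with
          | .read next endOfStream =>
            match c.rest with
            | [] => buf endOfStream = buf c.mem
            | e :: _ => buf (next e) = if e.IsDiag then buf c.mem else
                Function.update (buf c.mem) 0 (insert e (buf c.mem 0))
          | .flip a b => buf a = buf c.mem ∧ buf b = buf c.mem
          | .call => True
          | .halt F => F = (Finset.range t).biUnion (buf c.mem)
        | some _ =>
          src c.mem + 1 < t ∧
          (∀ u v, A.adj c.mem u v = true ↔ s(u, v) ∈ buf c.mem (src c.mem)) ∧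
          (∀ e, src (A.recv c.mem e) = src c.mem ∧
            (buf (A.recv c.mem e) = Function.update (buf c.mem) (src c.mem + 1)
                (insert e (buf c.mem (src c.mem + 1))) ∨
              (buf (A.recv c.mem e) = buf c.mem ∧
                2 * s ≤ (buf c.mem (src c.mem + 1)).card))) ∧
          buf (A.ret c.mem) = Function.update (buf c.mem) (src c.mem) ∅

end StreamAlg

/-- The binary logarithm inside an asymptotic bound, replaced by `1` where it is below `1`. -/
noncomputable def log₂ (x : ℝ) : ℝ := max 1 (Real.logb 2 x)

/-! The algorithm is a binary counter of covers. Buffer `0` collects `b = ⌈m/k⌉` distinct edges and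
is then reduced to a cover placed in buffer `1`. When a buffer receives a second cover, the two are
merged and reduced into the next buffer, which is a carry of the counter. Buffer `0` fills at most
`k` times, so about `log k` levels suffice.

Correctness rests on two facts about covers: a cover of a cover is a cover
(`IsMatchingCover.trans`), and a union of covers covers the union of the graphs
(`IsMatchingCover.union`), the losses adding up both times. For the union, split a maximum matching
into an edge set for each graph. The two sets have disjoint endpoints, so matchings found separately
between these endpoints combine to one matching. Since the untouched buffers cover themselves
without loss, a call with loss `δ` worsens the union of all buffers by `δ` only.

There are at most `2 * k` calls: each filling of buffer `0` pays for its own call and for one later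
carry, which is the potential argument in `RestInvariant` and `CallInvariant`. With `δ = α / (2 *
k)` the total loss is at most `α`, and success probability `1 - p` per call gives `(1 - p) ^ (2 * k)
≥ 1 - 2 * k * p`.

For the space, a set of at most `r` edges takes `O(r log (n² / r))` bits
(`logb_card_small_edge_sets_le`). There is one buffer of size `b`, and there are `O(log k)` buffers
of size `2 * s`. The degenerate cases `k = 1` and `s = 0` need fewer buffers and are treated by
`numLevels`. -/

open scoped ENNReal

/-! ### Matchings as sets of pairwise disjoint edges -/

/-- Distinct edges in `F` share no vertex. -/
def PairwiseDisjointEdges {V : Type} (F : Finset (Sym2 V)) : Prop :=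
  ∀ e ∈ F, ∀ f ∈ F, ∀ v, v ∈ e → v ∈ f → e = f

theorem bddAbove_matching_sizes {V : Type} [Finite V] (G : SimpleGraph V) :
    BddAbove {r | ∃ M : G.Subgraph, M.IsMatching ∧ M.edgeSet.ncard = r} := by
  refine ⟨Nat.card (Sym2 V), ?_⟩
  rintro r ⟨M, -, rfl⟩
  exact Set.ncard_le_card _

/-- Together with `exists_card_eq_matchingNumber`, this trades subgraphs for finite edge sets, which
are easier to split and to unite. -/
theorem card_le_matchingNumber {V : Type} [Finite V] {G : SimpleGraph V} {F : Finset (Sym2 V)}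
    (hF : (F : Set (Sym2 V)) ⊆ G.edgeSet) (hd : PairwiseDisjointEdges F) :
    F.card ≤ matchingNumber G := by
  let M : G.Subgraph :=
    { verts := {v | ∃ e ∈ F, v ∈ e}
      Adj := fun u v => s(u, v) ∈ F
      adj_sub := fun {u v} h => by simpa using hF h
      edge_vert := fun {u v} h => ⟨s(u, v), h, Sym2.mem_mk_left u v⟩
      symm := ⟨fun u v h => by rwa [Sym2.eq_swap]⟩ }
  have hM : M.IsMatching := by
    rintro v ⟨e, he, hv⟩
    obtain ⟨w, rfl⟩ := Sym2.mem_iff_exists.mp hv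
    refine ⟨w, he, fun y hy => ?_⟩
    have := hd _ hy _ he v (Sym2.mem_mk_left _ _) hv
    exact (Sym2.congr_right.mp this).symm ▸ rfl
  have hE : M.edgeSet = (F : Set (Sym2 V)) := by
    ext e
    induction e with
    | _ u v => simp [M]
  refine le_csSup (bddAbove_matching_sizes G) ⟨M, hM, ?_⟩
  rw [hE, Set.ncard_coe_finset]

theorem exists_card_eq_matchingNumber {V : Type} [Finite V] (G : SimpleGraph V) :
    ∃ F : Finset (Sym2 V), (F : Set (Sym2 V)) ⊆ G.edgeSet ∧ PairwiseDisjointEdges F ∧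
      F.card = matchingNumber G := by
  have hne : {r | ∃ M : G.Subgraph, M.IsMatching ∧ M.edgeSet.ncard = r}.Nonempty :=
    ⟨_, ⊥, by simp [SimpleGraph.Subgraph.IsMatching], rfl⟩
  obtain ⟨M, hM, hr⟩ := Nat.sSup_mem hne (bddAbove_matching_sizes G)
  refine ⟨(Set.toFinite M.edgeSet).toFinset, ?_, ?_, ?_⟩
  · simpa using M.edgeSet_subset
  · intro e he f hf v hve hvf
    obtain ⟨u, rfl⟩ := Sym2.mem_iff_exists.mp hve
    obtain ⟨w, rfl⟩ := Sym2.mem_iff_exists.mp hvf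
    simp only [Set.Finite.mem_toFinset, SimpleGraph.Subgraph.mem_edgeSet] at he hf
    rw [hM.eq_of_adj_left he hf]
  · rw [matchingNumber, ← hr, Set.ncard_eq_toFinset_card]

theorem mem_edgeSet_between {V : Type} {G : SimpleGraph V} {A B : Set V} {e : Sym2 V} :
    e ∈ (G.between A B).edgeSet ↔ e ∈ G.edgeSet ∧ ∃ u ∈ A, ∃ v ∈ B, e = s(u, v) := by
  induction e with
  | _ x y =>
    simp only [SimpleGraph.mem_edgeSet, SimpleGraph.between_adj, Sym2.eq_iff]
    constructor
    · rintro ⟨h, ⟨hx, hy⟩ | ⟨hx, hy⟩⟩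
      · exact ⟨h, x, hx, y, hy, Or.inl ⟨rfl, rfl⟩⟩
      · exact ⟨h, y, hy, x, hx, Or.inr ⟨rfl, rfl⟩⟩
    · rintro ⟨h, u, hu, v, hv, ⟨rfl, rfl⟩ | ⟨rfl, rfl⟩⟩
      · exact ⟨h, Or.inl ⟨hu, hv⟩⟩
      · exact ⟨h, Or.inr ⟨hv, hu⟩⟩

/-! ### Composing matching covers -/

theorem IsMatchingCover.mono {n : ℕ} {α β : ℝ} {G : SimpleGraph (Fin n)}
    {F : Finset (Sym2 (Fin n))} (h : IsMatchingCover α G F) (hαβ : α ≤ β) :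
    IsMatchingCover β G F :=
  ⟨h.1, fun A B hAB => le_trans
    (sub_le_sub_left (mul_le_mul_of_nonneg_right hαβ (Nat.cast_nonneg n)) _) (h.2 A B hAB)⟩

theorem IsMatchingCover.refl {n : ℕ} {F : Finset (Sym2 (Fin n))} (hF : ∀ e ∈ F, ¬ e.IsDiag) :
    IsMatchingCover 0 (SimpleGraph.fromEdgeSet (F : Set (Sym2 (Fin n)))) F := by
  refine ⟨fun e he => ?_, fun A B _ => by simp⟩
  rw [SimpleGraph.edgeSet_fromEdgeSet]
  exact ⟨he, hF e he⟩

theorem IsMatchingCover.not_isDiag {n : ℕ} {α : ℝ} {G : SimpleGraph (Fin n)}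
    {F : Finset (Sym2 (Fin n))} (h : IsMatchingCover α G F) {e : Sym2 (Fin n)} (he : e ∈ F) :
    ¬ e.IsDiag :=
  G.not_isDiag_of_mem_edgeSet (h.1 he)

theorem IsMatchingCover.trans {n : ℕ} {α β : ℝ} {G : SimpleGraph (Fin n)}
    {F F' : Finset (Sym2 (Fin n))} (h : IsMatchingCover α G F)
    (h' : IsMatchingCover β (SimpleGraph.fromEdgeSet (F : Set (Sym2 (Fin n)))) F') :
    IsMatchingCover (α + β) G F' := by
  refine ⟨fun e he => h.1 ?_, fun A B hAB => ?_⟩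
  · have := h'.1 he
    rw [SimpleGraph.edgeSet_fromEdgeSet] at this
    exact this.1
  · have h₁ := h.2 A B hAB
    have h₂ := h'.2 A B hAB
    linarith

/-- A cover keeps a large matching between the endpoints of any given matching. -/
theorem IsMatchingCover.exists_matching {n : ℕ} {α : ℝ} {G : SimpleGraph (Fin n)}
    {F M : Finset (Sym2 (Fin n))} (h : IsMatchingCover α G F) {A B : Set (Fin n)}
    (hAB : Disjoint A B) (hMG : (M : Set (Sym2 (Fin n))) ⊆ (G.between A B).edgeSet)
    (hM : PairwiseDisjointEdges M) :
    ∃ N : Finset (Sym2 (Fin n)), N ⊆ F ∧ PairwiseDisjointEdges N ∧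
      (∀ e ∈ N, e ∈ ((SimpleGraph.fromEdgeSet (F : Set (Sym2 (Fin n)))).between A B).edgeSet ∧
        ∀ v ∈ e, ∃ f ∈ M, v ∈ f) ∧ (M.card : ℝ) - α * n ≤ N.card := by
  let W : Set (Fin n) := {v | ∃ f ∈ M, v ∈ f}
  have hM' : (M : Set (Sym2 (Fin n))) ⊆ (G.between (A ∩ W) (B ∩ W)).edgeSet := by
    intro e he
    obtain ⟨heG, u, hu, v, hv, rfl⟩ := mem_edgeSet_between.mp (hMG he)
    exact mem_edgeSet_between.mpr ⟨heG, u, ⟨hu, _, he, Sym2.mem_mk_left _ _⟩, v,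
      ⟨hv, _, he, Sym2.mem_mk_right _ _⟩, rfl⟩
  obtain ⟨N, hNF, hN, hcard⟩ := exists_card_eq_matchingNumber
    ((SimpleGraph.fromEdgeSet (F : Set (Sym2 (Fin n)))).between (A ∩ W) (B ∩ W))
  refine ⟨N, fun e he => ?_, hN, fun e he => ?_, ?_⟩
  · have := (mem_edgeSet_between.mp (hNF he)).1
    rw [SimpleGraph.edgeSet_fromEdgeSet] at this
    exact this.1
  · obtain ⟨heF, u, hu, v, hv, rfl⟩ := mem_edgeSet_between.mp (hNF he)
    refine ⟨mem_edgeSet_between.mpr ⟨heF, u, hu.1, v, hv.1, rfl⟩, fun w hw => ?_⟩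
    rcases Sym2.mem_iff.mp hw with rfl | rfl
    exacts [hu.2, hv.2]
  · have h₁ := h.2 (A ∩ W) (B ∩ W) (hAB.mono Set.inter_subset_left Set.inter_subset_left)
    have h₂ : (M.card : ℝ) ≤ matchingNumber (G.between (A ∩ W) (B ∩ W)) := by
      exact_mod_cast card_le_matchingNumber hM' hM
    rw [hcard]
    linarith

theorem PairwiseDisjointEdges.mono {V : Type} {F F' : Finset (Sym2 V)}
    (h : PairwiseDisjointEdges F) (hs : F' ⊆ F) : PairwiseDisjointEdges F' :=
  fun e he f hf => h e (hs he) f (hs hf)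

/-- A maximum matching is split into its edges in `S₁` and the rest. Each cover is applied only
between the endpoints of its own part, so the two resulting matchings cannot share a vertex. -/
theorem IsMatchingCover.union {n : ℕ} {α β : ℝ} {S₁ S₂ : Set (Sym2 (Fin n))}
    {F₁ F₂ : Finset (Sym2 (Fin n))}
    (h₁ : IsMatchingCover α (SimpleGraph.fromEdgeSet S₁) F₁)
    (h₂ : IsMatchingCover β (SimpleGraph.fromEdgeSet S₂) F₂) :
    IsMatchingCover (α + β) (SimpleGraph.fromEdgeSet (S₁ ∪ S₂)) (F₁ ∪ F₂) := by
  classical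
  refine ⟨?_, fun A B hAB => ?_⟩
  · rw [Finset.coe_union]
    refine Set.union_subset (h₁.1.trans ?_) (h₂.1.trans ?_) <;>
      exact SimpleGraph.edgeSet_mono (SimpleGraph.fromEdgeSet_mono (by simp))
  obtain ⟨M, hMG, hM, hcard⟩ := exists_card_eq_matchingNumber
    ((SimpleGraph.fromEdgeSet (S₁ ∪ S₂)).between A B)
  have hmem : ∀ e ∈ M, (e ∈ S₁ ∨ e ∈ S₂) ∧ ¬ e.IsDiag ∧ ∃ u ∈ A, ∃ v ∈ B, e = s(u, v) := by
    intro e he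
    obtain ⟨h, hAB'⟩ := mem_edgeSet_between.mp (hMG he)
    rw [SimpleGraph.edgeSet_fromEdgeSet] at h
    exact ⟨h.1, h.2, hAB'⟩
  have key : ∀ (S : Set (Sym2 (Fin n))) (M' : Finset (Sym2 (Fin n))), M' ⊆ M →
      (∀ e ∈ M', e ∈ S) →
      (M' : Set (Sym2 (Fin n))) ⊆ ((SimpleGraph.fromEdgeSet S).between A B).edgeSet := by
    intro S M' hsub hS e he
    refine mem_edgeSet_between.mpr ⟨?_, (hmem e (hsub he)).2.2⟩
    rw [SimpleGraph.edgeSet_fromEdgeSet]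
    exact ⟨hS e he, (hmem e (hsub he)).2.1⟩
  have hs₁ : M.filter (· ∈ S₁) ⊆ M := Finset.filter_subset _ _
  have hs₂ : M.filter (· ∉ S₁) ⊆ M := Finset.filter_subset _ _
  obtain ⟨N₁, hN₁F, hN₁, hN₁e, hc₁⟩ := h₁.exists_matching hAB
    (key S₁ (M.filter (· ∈ S₁)) hs₁ fun e he => (Finset.mem_filter.mp he).2) (hM.mono hs₁)
  obtain ⟨N₂, hN₂F, hN₂, hN₂e, hc₂⟩ := h₂.exists_matching hAB
    (key S₂ (M.filter (· ∉ S₁)) hs₂ fun e he =>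
      ((hmem e (hs₂ he)).1).resolve_left (Finset.mem_filter.mp he).2) (hM.mono hs₂)
  -- A common vertex would be an endpoint of an edge of `M` in `S₁` and of one outside `S₁`. These
  -- two edges coincide because `M` is a matching.
  have hcross : ∀ e ∈ N₁, ∀ f ∈ N₂, ∀ v, v ∈ e → v ∈ f → False := by
    intro e he f hf v hve hvf
    obtain ⟨e', he', hve'⟩ := (hN₁e e he).2 v hve
    obtain ⟨f', hf', hvf'⟩ := (hN₂e f hf).2 v hvf
    have := hM e' (hs₁ he') f' (hs₂ hf') v hve' hvf'
    subst this
    exact (Finset.mem_filter.mp hf').2 (Finset.mem_filter.mp he').2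
  have hdisj : Disjoint N₁ N₂ := by
    rw [Finset.disjoint_left]
    intro e he he'
    obtain ⟨v, hv⟩ : ∃ v, v ∈ e := by
      induction e with
      | _ x y => exact ⟨x, Sym2.mem_mk_left _ _⟩
    exact hcross e he e he' v hv hv
  have hle : (N₁ ∪ N₂).card ≤ matchingNumber
      ((SimpleGraph.fromEdgeSet ((F₁ ∪ F₂ : Finset _) : Set (Sym2 (Fin n)))).between A B) := by
    apply card_le_matchingNumber
    · intro e he
      have hmono : ∀ F ⊆ F₁ ∪ F₂,
          e ∈ ((SimpleGraph.fromEdgeSet (F : Set (Sym2 (Fin n)))).between A B).edgeSet →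
          e ∈ ((SimpleGraph.fromEdgeSet ((F₁ ∪ F₂ : Finset _) : Set (Sym2 (Fin n)))).between
            A B).edgeSet := by
        intro F hF h
        rw [mem_edgeSet_between] at h ⊢
        exact ⟨SimpleGraph.edgeSet_mono
          (SimpleGraph.fromEdgeSet_mono (Finset.coe_subset.mpr hF)) h.1, h.2⟩
      rcases Finset.mem_union.mp (Finset.mem_coe.mp he) with he | he
      · exact hmono F₁ Finset.subset_union_left (hN₁e e he).1
      · exact hmono F₂ Finset.subset_union_right (hN₂e e he).1
    · intro e he f hf v hve hvf
      rcases Finset.mem_union.mp he with he | he <;> rcases Finset.mem_union.mp hf with hf | hf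
      · exact hN₁ e he f hf v hve hvf
      · exact (hcross e he f hf v hve hvf).elim
      · exact (hcross f hf e he v hvf hve).elim
      · exact hN₂ e he f hf v hve hvf
  rw [Finset.card_union_of_disjoint hdisj] at hle
  have hle' : (N₁.card : ℝ) + N₂.card ≤ matchingNumber
      ((SimpleGraph.fromEdgeSet ((F₁ ∪ F₂ : Finset _) : Set (Sym2 (Fin n)))).between A B) := by
    exact_mod_cast hle
  have hsum : ((M.filter (· ∈ S₁)).card : ℝ) + (M.filter (· ∉ S₁)).card = M.card := by
    exact_mod_cast Finset.card_filter_add_card_filter_not (s := M) (· ∈ S₁)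
  rw [← hcard]
  linarith

/-! ### Hitting probabilities of randomized machines -/

theorem coin_self {K : Type} (a : K) : coin a a = PMF.pure a := by
  simp [coin, PMF.map_const, Function.const_def]

theorem toOuterMeasure_coin_bind {K L : Type} (a b : K) (f : K → PMF L) (E : Set L) :
    ((coin a b).bind f).toOuterMeasure E =
      2⁻¹ * (f a).toOuterMeasure E + 2⁻¹ * (f b).toOuterMeasure E := by
  rw [coin, PMF.bind_map, PMF.toOuterMeasure_bind_apply, tsum_bool]
  simp [add_comm]

theorem eq_of_coin_eq_pure {K : Type} {a b c : K} (h : coin a b = PMF.pure c) : a = b := by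
  have hs : (coin a b).support = {c} := by rw [h, PMF.support_pure]
  have ha : a ∈ (coin a b).support := by
    rw [coin, PMF.support_map]
    exact ⟨true, by simp, by simp⟩
  have hb : b ∈ (coin a b).support := by
    rw [coin, PMF.support_map]
    exact ⟨false, by simp, by simp⟩
  rw [hs] at ha hb
  exact ha.trans hb.symm

theorem mem_support_coin {K : Type} {a b c : K} (h : c ∈ (coin a b).support) : c = a ∨ c = b := by
  rw [coin, PMF.support_map] at h
  obtain ⟨r, -, rfl⟩ := h
  cases r <;> simp

section

variable {K : Type} {step : K → PMF K}

theorem runFor_succ (T : ℕ) (c : K) :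
    runFor step (T + 1) c = (step c).bind (runFor step T) := rfl

theorem runFor_of_pure {c c' : K} (h : step c = PMF.pure c') (T : ℕ) :
    runFor step (T + 1) c = runFor step T c' := by
  rw [runFor_succ, h, PMF.pure_bind]

theorem runFor_of_halted {c : K} (h : step c = PMF.pure c) (T : ℕ) :
    runFor step T c = PMF.pure c := by
  induction T with
  | zero => rfl
  | succ T ih => rw [runFor_of_pure h, ih]

theorem Reachable.invariant {P : K → Prop} (hP : ∀ c, P c → ∀ c' ∈ (step c).support, P c')
    {c c' : K} (hc : P c) (h : Reachable step c c') : P c' := by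
  obtain ⟨T, hT⟩ := h
  induction T generalizing c with
  | zero =>
    rw [runFor, PMF.support_pure] at hT
    rw [Set.mem_singleton_iff.mp hT]
    exact hc
  | succ T ih =>
    rw [runFor_succ, PMF.mem_support_bind_iff] at hT
    obtain ⟨d, hd, hT⟩ := hT
    exact ih (hP c hc d hd) hT

theorem haltProb_of_pure {c c' : K} (h : step c = PMF.pure c') (E : Set K) :
    haltProb step c' E ≤ haltProb step c E := by
  refine iSup_le fun T => ?_
  rw [← runFor_of_pure h]
  exact le_iSup (fun T => (runFor step T c).toOuterMeasure E) (T + 1)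

theorem haltProb_of_mem {c : K} {E : Set K} (h : c ∈ E) : 1 ≤ haltProb step c E := by
  refine le_trans ?_ (le_iSup (fun T => (runFor step T c).toOuterMeasure E) 0)
  rw [runFor, PMF.toOuterMeasure_pure_apply, if_pos h]

theorem runFor_monotone {E : Set K} (hE : ∀ c ∈ E, step c = PMF.pure c) (c : K) :
    Monotone fun T => (runFor step T c).toOuterMeasure E := by
  refine monotone_nat_of_le_succ fun T => ?_
  induction T generalizing c with
  | zero =>
    rw [runFor, PMF.toOuterMeasure_pure_apply]
    split_ifs with h
    · rw [runFor_of_halted (hE c h), PMF.toOuterMeasure_pure_apply, if_pos h]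
    · exact zero_le
  | succ T ih =>
    rw [runFor_succ (T + 1), runFor_succ T, PMF.toOuterMeasure_bind_apply,
      PMF.toOuterMeasure_bind_apply]
    exact ENNReal.tsum_le_tsum fun d => mul_le_mul_right (ih d) _

/-- Adding the two suprema termwise needs both sequences to be monotone in the number of steps. They
are, because configurations in `E` are stationary. -/
theorem haltProb_of_coin {E : Set K} (hE : ∀ c ∈ E, step c = PMF.pure c) {c a b : K}
    (h : step c = coin a b) :
    2⁻¹ * haltProb step a E + 2⁻¹ * haltProb step b E ≤ haltProb step c E := by
  rw [haltProb, haltProb, ENNReal.mul_iSup, ENNReal.mul_iSup,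
    ENNReal.iSup_add_iSup_of_monotone
      (fun _ _ hT => mul_le_mul_right (runFor_monotone hE a hT) _)
      (fun _ _ hT => mul_le_mul_right (runFor_monotone hE b hT) _)]
  refine iSup_le fun T => ?_
  rw [← toOuterMeasure_coin_bind, ← h, ← runFor_succ]
  exact le_iSup (fun T => (runFor step T c).toOuterMeasure E) (T + 1)

end

/-! ### Simulating a subroutine call -/

namespace Subroutine

variable {n : ℕ} {S : Subroutine n} {G : SimpleGraph (Fin n)}

/-- The written set never shrinks, so a run that has exceeded `s` edges cannot succeed. Hence a
simulation has to be faithful only up to that point. -/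
theorem runFor_apply_eq_zero_of_lt_card {s : ℕ} {P : S.Config → Prop} (T : ℕ) (x : S.Config)
    (hx : s < x.out.card) :
    (runFor (S.step G) T x).toOuterMeasure {c | P c ∧ c.out.card ≤ s} = 0 := by
  induction T generalizing x with
  | zero =>
    rw [runFor, PMF.toOuterMeasure_pure_apply, if_neg]
    exact fun h => absurd h.2 (not_le.mpr hx)
  | succ T ih =>
    cases hop : S.op x.mem with
    | query u v no yes =>
      rw [runFor_of_pure (by rw [step, hop])]
      exact ih _ hx
    | flip a b =>
      rw [runFor_succ, step, hop]
      dsimp only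
      rw [toOuterMeasure_coin_bind, ih ⟨a, x.out⟩ hx, ih ⟨b, x.out⟩ hx]
      simp
    | emit e q =>
      rw [runFor_of_pure (by rw [step, hop])]
      exact ih _ (hx.trans_le (Finset.card_le_card (Finset.subset_insert _ _)))
    | halt =>
      rw [runFor_of_pure (c' := x) (by rw [step, hop])]
      exact ih _ hx

end Subroutine

namespace StreamAlg

variable {n : ℕ}

/-- If the memory tracks the output of the subroutine as long as it is small, then a call succeeds
at least as often as the subroutine does. `R o y` says that `y` is the memory after the edges `o`
have been written. -/
theorem haltProb_call {A : StreamAlg n} {S : Subroutine n} {E : Set (A.Config S)}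
    (hE : ∀ c ∈ E, A.step S c = PMF.pure c) {G : SimpleGraph (Fin n)} {s : ℕ}
    {P : Finset (Sym2 (Fin n)) → Prop} {R : Finset (Sym2 (Fin n)) → A.M → Prop} {θ : ℝ≥0∞}
    {rest : List (Sym2 (Fin n))} {a : ℕ}
    (hadj : ∀ o y, R o y → ∀ u v, A.adj y u v = true ↔ G.Adj u v)
    (hrecv : ∀ o y e, R o y → (insert e o).card ≤ s → R (insert e o) (A.recv y e))
    (hret : ∀ o y, R o y → P o → o.card ≤ s →
      θ ≤ haltProb (A.step S) ⟨A.ret y, none, rest, a⟩ E)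
    {y : A.M} (hy : R ∅ y) :
    haltProb (S.step G) ⟨S.start, ∅⟩ {c | S.op c.mem = .halt ∧ P c.out ∧ c.out.card ≤ s} * θ ≤
      haltProb (A.step S) ⟨y, some S.start, rest, a⟩ E := by
  classical
  have main : ∀ (T : ℕ) (x : S.Config) (y : A.M), R x.out y →
      (runFor (S.step G) T x).toOuterMeasure
        {c | S.op c.mem = .halt ∧ P c.out ∧ c.out.card ≤ s} * θ ≤
      haltProb (A.step S) ⟨y, some x.mem, rest, a⟩ E := by
    intro T
    induction T with
    | zero =>
      intro x y hxy
      rw [runFor, PMF.toOuterMeasure_pure_apply]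
      split_ifs with h
      · rw [one_mul]
        refine (hret _ _ hxy h.2.1 h.2.2).trans (haltProb_of_pure ?_ E)
        simp [StreamAlg.step, h.1]
      · simp
    | succ T ih =>
      intro x y hxy
      cases hop : S.op x.mem with
      | query u v no yes =>
        rw [runFor_of_pure (by rw [Subroutine.step, hop])]
        refine le_trans ?_ (haltProb_of_pure
          (c' := ⟨y, some (if A.adj y u v then yes else no), rest, a⟩)
          (by simp [StreamAlg.step, hop]) E)
        have := ih ⟨if G.Adj u v then yes else no, x.out⟩ y hxy
        simpa only [hadj _ _ hxy u v] using this
      | flip q q' =>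
        rw [runFor_succ, Subroutine.step, hop]
        dsimp only
        rw [toOuterMeasure_coin_bind]
        refine le_trans ?_ (haltProb_of_coin hE
          (a := ⟨y, some q, rest, a⟩) (b := ⟨y, some q', rest, a⟩)
          (by simp [StreamAlg.step, hop]))
        rw [add_mul, mul_assoc, mul_assoc]
        exact add_le_add (mul_le_mul_right (ih ⟨q, x.out⟩ y hxy) _)
          (mul_le_mul_right (ih ⟨q', x.out⟩ y hxy) _)
      | emit e q =>
        rw [runFor_of_pure (by rw [Subroutine.step, hop])]
        by_cases hs : (insert e x.out).card ≤ s
        · refine le_trans (ih ⟨q, insert e x.out⟩ (A.recv y e) (hrecv _ _ _ hxy hs))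
            (haltProb_of_pure ?_ E)
          simp [StreamAlg.step, hop]
        -- Here the buffer may have refused an edge, but the run contributes nothing to the
        -- left-hand side.
        · have h0 := Subroutine.runFor_apply_eq_zero_of_lt_card (S := S) (G := G)
            (P := fun c => S.op c.mem = .halt ∧ P c.out) T ⟨q, insert e x.out⟩ (not_le.mp hs)
          simp only [and_assoc] at h0
          rw [h0, zero_mul]
          exact zero_le
      | halt =>
        rw [runFor_of_pure (c' := x) (by rw [Subroutine.step, hop])]
        exact ih x y hxy
  rw [haltProb, ENNReal.iSup_mul]
  exact iSup_le fun T => main T ⟨S.start, ∅⟩ y hy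

end StreamAlg

/-! ### Counting small edge sets -/

theorem one_le_log₂ (x : ℝ) : 1 ≤ log₂ x := le_max_left _ _

theorem log₂_mono {x y : ℝ} (hx : 0 < x) (h : x ≤ y) : log₂ x ≤ log₂ y :=
  max_le_max le_rfl (Real.logb_le_logb_of_le one_lt_two hx h)

/-- Expand `(1 + x) ^ |E|` as the sum of `x ^ |F|` over all subsets `F`; since `x ≤ 1`, each small
subset contributes at least `x ^ r`. -/
theorem card_small_finsets_mul_pow_le {E : Type} [Fintype E] (r : ℕ) {x : ℝ}
    (hx₀ : 0 ≤ x) (hx₁ : x ≤ 1) :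
    (Nat.card {F : Finset E // F.card ≤ r} : ℝ) * x ^ r ≤ (1 + x) ^ Fintype.card E := by
  classical
  have hsum := Finset.sum_pow_mul_eq_add_pow x 1 (Finset.univ : Finset E)
  simp only [one_pow, mul_one, Finset.powerset_univ, Finset.card_univ] at hsum
  rw [add_comm 1 x, ← hsum, Nat.card_eq_fintype_card, Fintype.card_subtype]
  calc ((Finset.univ.filter fun F : Finset E => F.card ≤ r).card : ℝ) * x ^ r
      = ∑ F ∈ Finset.univ.filter fun F : Finset E => F.card ≤ r, x ^ r := by simp
    _ ≤ ∑ F ∈ Finset.univ.filter fun F : Finset E => F.card ≤ r, x ^ F.card :=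
        Finset.sum_le_sum fun F hF =>
          pow_le_pow_of_le_one hx₀ hx₁ (Finset.mem_filter.mp hF).2
    _ ≤ ∑ F : Finset E, x ^ F.card :=
        Finset.sum_le_sum_of_subset_of_nonneg (Finset.filter_subset _ _)
          fun F _ _ => pow_nonneg hx₀ _

theorem card_sym2_fin_le (n : ℕ) : Fintype.card (Sym2 (Fin n)) ≤ n ^ 2 := by
  rw [Sym2.card, Fintype.card_fin, Nat.choose_two_right, Nat.add_sub_cancel]
  refine Nat.div_le_of_le_mul ?_
  nlinarith [Nat.le_self_pow (two_ne_zero) n]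

/-- The generating function bound at `x = r / n²` gives at most `(e n² / r) ^ r` sets. If `r ≥ n²`,
then `x = 1` is used instead and gives at most `2 ^ r`. -/
theorem logb_card_small_edge_sets_le (n r : ℕ) :
    Real.logb 2 ((Nat.card {F : Finset (Sym2 (Fin n)) // F.card ≤ r} : ℕ) : ℝ) ≤
      5 / 2 * (r * log₂ ((n : ℝ) ^ 2 / r)) := by
  set K : ℝ := ((Nat.card {F : Finset (Sym2 (Fin n)) // F.card ≤ r} : ℕ) : ℝ) with hK
  have hN : (Fintype.card (Sym2 (Fin n)) : ℝ) ≤ (n : ℝ) ^ 2 := by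
    exact_mod_cast card_sym2_fin_le n
  have hKpos : 0 < K := by
    rw [hK, Nat.cast_pos]
    have : Nonempty {F : Finset (Sym2 (Fin n)) // F.card ≤ r} := ⟨⟨∅, by simp⟩⟩
    exact Nat.card_pos
  rcases Nat.eq_zero_or_pos r with rfl | hr
  · have : K = 1 := by
      have h : {F : Finset (Sym2 (Fin n)) // F.card ≤ 0} =
          {F : Finset (Sym2 (Fin n)) // F = ∅} := by simp
      rw [hK, h]
      simp
    simp [this]
  have hr' : (0 : ℝ) < r := Nat.cast_pos.mpr hr
  have hlog := one_le_log₂ ((n : ℝ) ^ 2 / r)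
  rcases le_or_gt ((n : ℝ) ^ 2) r with hnr | hnr
  · have h := card_small_finsets_mul_pow_le (E := Sym2 (Fin n)) r zero_le_one le_rfl
    rw [one_pow, mul_one, one_add_one_eq_two, ← Real.rpow_natCast] at h
    have h' : Real.logb 2 K ≤ Fintype.card (Sym2 (Fin n)) := by
      rw [Real.logb_le_iff_le_rpow one_lt_two hKpos]
      exact h
    nlinarith
  · have hM : (0 : ℝ) < (n : ℝ) ^ 2 := hr'.trans hnr
    set x : ℝ := r / (n : ℝ) ^ 2 with hx
    have hx₀ : 0 < x := div_pos hr' hM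
    have hx₁ : x ≤ 1 := (div_le_one hM).mpr hnr.le
    have h := card_small_finsets_mul_pow_le (E := Sym2 (Fin n)) r hx₀.le hx₁
    have hexp : (1 + x) ^ Fintype.card (Sym2 (Fin n)) ≤ Real.exp r := by
      calc (1 + x) ^ Fintype.card (Sym2 (Fin n))
          ≤ Real.exp x ^ Fintype.card (Sym2 (Fin n)) :=
            pow_le_pow_left₀ (by positivity) (by linarith [Real.add_one_le_exp x]) _
        _ = Real.exp (Fintype.card (Sym2 (Fin n)) * x) := (Real.exp_nat_mul _ _).symm
        _ ≤ Real.exp r := by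
            rw [Real.exp_le_exp]
            calc _ ≤ (n : ℝ) ^ 2 * x := mul_le_mul_of_nonneg_right hN hx₀.le
              _ = r := by rw [hx]; exact mul_div_cancel₀ _ hM.ne'
    have hle := Real.log_le_log (by positivity) (h.trans hexp)
    rw [Real.log_mul hKpos.ne' (by positivity), Real.log_pow, Real.log_exp] at hle
    have hxlog : Real.log x = - Real.log ((n : ℝ) ^ 2 / r) := by
      rw [hx, ← Real.log_inv, inv_div]
    rw [hxlog] at hle
    have h2 : (2 / 3 : ℝ) ≤ Real.log 2 := by linarith [Real.log_two_gt_d9]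
    have hL : Real.log ((n : ℝ) ^ 2 / r) ≤ Real.log 2 * log₂ ((n : ℝ) ^ 2 / r) := by
      have : Real.logb 2 ((n : ℝ) ^ 2 / r) ≤ log₂ ((n : ℝ) ^ 2 / r) := le_max_right _ _
      rw [Real.logb, div_le_iff₀ (by linarith)] at this
      linarith
    rw [Real.logb, div_le_iff₀ (by linarith)]
    have h3 : (r : ℝ) * Real.log ((n : ℝ) ^ 2 / r) ≤
        r * (Real.log 2 * log₂ ((n : ℝ) ^ 2 / r)) := mul_le_mul_of_nonneg_left hL hr'.le
    -- The factor `e ^ r` costs `r / ln 2 ≤ 3/2 * r` bits, since `ln 2 ≥ 2/3`; together with the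
    -- main term this gives the constant `5/2`.
    have h4 : (r : ℝ) * 1 ≤ r * (3 / 2 * (Real.log 2 * log₂ ((n : ℝ) ^ 2 / r))) :=
      mul_le_mul_of_nonneg_left (by nlinarith) hr'.le
    linarith

/-! ### The merge-and-reduce algorithm -/

/-- What the algorithm is about to do: read an edge, run the subroutine on buffer `i`, or halt. -/
inductive MergePhase where
  | reading
  | calling (i : ℕ)
  | halted

/-- Memory of the merge-and-reduce algorithm with buffers `0, ..., L`: buffer `0` holds at most `b`
edges, the others at most `r`. The set `occ` contains those `j` for which buffer `j + 1` already
holds the output of a call. -/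
@[ext]
structure MergeState (n b r L : ℕ) where
  phase : MergePhase
  buf : ℕ → Finset (Sym2 (Fin n))
  occ : Finset ℕ
  phase_lt : ∀ i, phase = .calling i → i < L
  card_zero : (buf 0).card ≤ b
  card_succ : ∀ j, (buf (j + 1)).card ≤ r
  buf_eq : ∀ j, L < j → buf j = ∅
  occ_lt : ∀ j ∈ occ, j < L

namespace MergeState

variable {n b r L : ℕ}

/-- The empty memory. -/
def empty : MergeState n b r L where
  phase := .reading
  buf := fun _ => ∅
  occ := ∅
  phase_lt := by simp
  card_zero := by simp
  card_succ := by simp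
  buf_eq := by simp
  occ_lt := by simp

/-- Halt and output the buffers. -/
def finish (x : MergeState n b r L) : MergeState n b r L :=
  { x with
    phase := .halted
    phase_lt := by simp }

/-- Insert an edge read into buffer `0`, and prepare a call if the buffer is full. -/
def afterRead (x : MergeState n b r L) (e : Sym2 (Fin n)) : MergeState n b r L :=
  if e.IsDiag then x
  else if h : (insert e (x.buf 0)).card ≤ b then
    { x with
      phase := if 0 < L ∧ b ≤ (insert e (x.buf 0)).card then .calling 0 else .reading
      buf := Function.update x.buf 0 (insert e (x.buf 0))
      phase_lt := by
        intro i hi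
        split_ifs at hi with h'
        obtain rfl : 0 = i := by simpa using hi
        exact h'.1
      card_zero := by simpa using h
      card_succ := fun j => by simpa using x.card_succ j
      buf_eq := fun j hj => by
        rw [Function.update_of_ne (by omega)]
        exact x.buf_eq j hj }
  -- Dropping the edge keeps the memory finite by construction; `RestInvariant.card_insert_le`
  -- excludes this branch in actual executions.
  else x

/-- Insert an edge written by the subroutine into the next buffer, if there is room for it. -/
def receive (x : MergeState n b r L) (e : Sym2 (Fin n)) : MergeState n b r L :=
  match hp : x.phase with
  | .calling i =>
    if h : (insert e (x.buf (i + 1))).card ≤ r then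
      { x with
        buf := Function.update x.buf (i + 1) (insert e (x.buf (i + 1)))
        card_zero := by simpa using x.card_zero
        card_succ := fun j => by
          rcases eq_or_ne j i with rfl | hj
          · simpa using h
          · rw [Function.update_of_ne (by omega)]
            exact x.card_succ j
        buf_eq := fun j hj => by
          have := x.phase_lt i hp
          rw [Function.update_of_ne (by omega)]
          exact x.buf_eq j hj }
    else x
  | _ => x

/-- When the call on buffer `i` ends, empty this buffer. If buffer `i + 1` held the output of an
earlier call, it is reduced next. -/
def afterCall (x : MergeState n b r L) : MergeState n b r L :=
  match hp : x.phase with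
  | .calling i =>
    { x with
      -- This is a binary increment with digits `occ`: a carry clears digit `i`, otherwise the digit
      -- is set. The top level never carries.
      phase := if i ∈ x.occ ∧ i + 1 < L then .calling (i + 1) else .reading
      buf := Function.update x.buf i ∅
      occ := if i ∈ x.occ ∧ i + 1 < L then x.occ.erase i else insert i x.occ
      phase_lt := by
        intro j hj
        split_ifs at hj with h
        obtain rfl : i + 1 = j := by simpa using hj
        exact h.2
      card_zero := by
        rcases eq_or_ne 0 i with rfl | hi
        · simp
        · rw [Function.update_of_ne hi]
          exact x.card_zero
      card_succ := fun j => by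
        rcases eq_or_ne (j + 1) i with rfl | hi
        · simp
        · rw [Function.update_of_ne hi]
          exact x.card_succ j
      buf_eq := fun j hj => by
        rcases eq_or_ne j i with rfl | hi
        · simp
        · rw [Function.update_of_ne hi]
          exact x.buf_eq j hj
      occ_lt := by
        have := x.phase_lt i hp
        intro j hj
        split_ifs at hj with h
        · exact x.occ_lt j (Finset.mem_of_mem_erase hj)
        · rcases Finset.mem_insert.mp hj with rfl | hj
          · exact this
          · exact x.occ_lt j hj }
  | _ => x

theorem afterRead_of_isDiag (x : MergeState n b r L) {e : Sym2 (Fin n)} (he : e.IsDiag) :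
    x.afterRead e = x := if_pos he

theorem buf_afterRead {x : MergeState n b r L} {e : Sym2 (Fin n)} (he : ¬ e.IsDiag)
    (h : (insert e (x.buf 0)).card ≤ b) :
    (x.afterRead e).buf = Function.update x.buf 0 (insert e (x.buf 0)) := by
  rw [afterRead, if_neg he, dif_pos h]

theorem occ_afterRead (x : MergeState n b r L) (e : Sym2 (Fin n)) :
    (x.afterRead e).occ = x.occ := by
  rw [afterRead]
  split_ifs <;> rfl

theorem phase_afterRead {x : MergeState n b r L} {e : Sym2 (Fin n)} (he : ¬ e.IsDiag)
    (h : (insert e (x.buf 0)).card ≤ b) :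
    (x.afterRead e).phase =
      if 0 < L ∧ b ≤ (insert e (x.buf 0)).card then .calling 0 else .reading := by
  rw [afterRead, if_neg he, dif_pos h]

section

variable {x : MergeState n b r L} {i : ℕ}

theorem buf_receive (hp : x.phase = .calling i) {e : Sym2 (Fin n)}
    (h : (insert e (x.buf (i + 1))).card ≤ r) :
    (x.receive e).buf = Function.update x.buf (i + 1) (insert e (x.buf (i + 1))) := by
  rw [receive]
  split
  · rename_i j hj
    obtain rfl : i = j := by simpa using hp.symm.trans hj
    rw [dif_pos h]
  · rename_i h'
    exact absurd hp (h' i)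

theorem receive_of_lt (hp : x.phase = .calling i) {e : Sym2 (Fin n)}
    (h : r < (insert e (x.buf (i + 1))).card) : x.receive e = x := by
  rw [receive]
  split
  · rename_i j hj
    obtain rfl : i = j := by simpa using hp.symm.trans hj
    rw [dif_neg (not_le.mpr h)]
  · rfl

theorem phase_receive (x : MergeState n b r L) (e : Sym2 (Fin n)) :
    (x.receive e).phase = x.phase := by
  rw [receive]
  split
  · split_ifs <;> rfl
  · rfl

theorem occ_receive (x : MergeState n b r L) (e : Sym2 (Fin n)) :
    (x.receive e).occ = x.occ := by
  rw [receive]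
  split
  · split_ifs <;> rfl
  · rfl

theorem buf_zero_receive (x : MergeState n b r L) (e : Sym2 (Fin n)) :
    (x.receive e).buf 0 = x.buf 0 := by
  rw [receive]
  split
  · split_ifs <;> simp
  · rfl

theorem buf_afterCall (hp : x.phase = .calling i) :
    x.afterCall.buf = Function.update x.buf i ∅ := by
  rw [afterCall]
  split
  · rename_i j hj
    obtain rfl : i = j := by simpa using hp.symm.trans hj
    rfl
  · rename_i h'
    exact absurd hp (h' i)

theorem phase_afterCall (hp : x.phase = .calling i) :
    x.afterCall.phase = if i ∈ x.occ ∧ i + 1 < L then .calling (i + 1) else .reading := by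
  rw [afterCall]
  split
  · rename_i j hj
    obtain rfl : i = j := by simpa using hp.symm.trans hj
    rfl
  · rename_i h'
    exact absurd hp (h' i)

theorem occ_afterCall (hp : x.phase = .calling i) :
    x.afterCall.occ =
      if i ∈ x.occ ∧ i + 1 < L then x.occ.erase i else insert i x.occ := by
  rw [afterCall]
  split
  · rename_i j hj
    obtain rfl : i = j := by simpa using hp.symm.trans hj
    rfl
  · rename_i h'
    exact absurd hp (h' i)

end

/-! ### Counting the memory states -/

/-- The finitely many data that determine a memory state. -/
def code (x : MergeState n b r L) :
    Option (Option (Fin L)) × {F : Finset (Sym2 (Fin n)) // F.card ≤ b} ×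
      (Fin L → {F : Finset (Sym2 (Fin n)) // F.card ≤ r}) × Finset (Fin L) :=
  (match hp : x.phase with
    | .reading => none
    | .halted => some none
    | .calling i => some (some ⟨i, x.phase_lt i hp⟩),
   ⟨x.buf 0, x.card_zero⟩, fun j => ⟨x.buf (j + 1), x.card_succ j⟩,
   Finset.univ.filter fun j : Fin L => (j : ℕ) ∈ x.occ)

theorem code_injective : Function.Injective (code : MergeState n b r L → _) := by
  intro x y h
  simp only [code, Prod.mk.injEq, Subtype.mk.injEq] at h
  obtain ⟨hp, h0, hs, ho⟩ := h
  have hphase : x.phase = y.phase := by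
    split at hp <;> split at hp <;> simp_all
  have hbuf : x.buf = y.buf := by
    funext j
    rcases j with _ | j
    · exact h0
    · by_cases hj : j < L
      · simpa using congrFun hs ⟨j, hj⟩
      · rw [x.buf_eq _ (by omega), y.buf_eq _ (by omega)]
  have hocc : x.occ = y.occ := by
    ext j
    by_cases hj : j < L
    · simpa using Finset.ext_iff.mp ho ⟨j, hj⟩
    · exact ⟨fun h => absurd (x.occ_lt j h) hj, fun h => absurd (y.occ_lt j h) hj⟩
  exact MergeState.ext hphase hbuf hocc

instance : Finite (MergeState n b r L) := Finite.of_injective code code_injective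

theorem logb_card_le :
    Real.logb 2 (Nat.card (MergeState n b r L)) ≤
      L + 2 + 5 / 2 * (b * log₂ ((n : ℝ) ^ 2 / b)) +
        L * (5 / 2 * (r * log₂ ((n : ℝ) ^ 2 / r)) + 1) := by
  set β := Nat.card {F : Finset (Sym2 (Fin n)) // F.card ≤ b} with hβ
  set ρ := Nat.card {F : Finset (Sym2 (Fin n)) // F.card ≤ r} with hρ
  have hβ₀ : β ≠ 0 := by
    have : Nonempty {F : Finset (Sym2 (Fin n)) // F.card ≤ b} := ⟨⟨∅, by simp⟩⟩
    exact Nat.card_pos.ne'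
  have hρ₀ : ρ ≠ 0 := by
    have : Nonempty {F : Finset (Sym2 (Fin n)) // F.card ≤ r} := ⟨⟨∅, by simp⟩⟩
    exact Nat.card_pos.ne'
  have : Nonempty (MergeState n b r L) := ⟨empty⟩
  have hcard : Nat.card (MergeState n b r L) ≤ 2 ^ (L + 2) * (β * (ρ ^ L * 2 ^ L)) := by
    refine (Nat.card_le_card_of_injective code code_injective).trans ?_
    simp only [Nat.card_prod, Nat.card_fun, ← hβ, ← hρ]
    -- The phase has only `L + 2` values; bounding these by `2 ^ (L + 2)` keeps the final sum linear
    -- in `L` and is cheap enough.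
    have h1 : Nat.card (Option (Option (Fin L))) ≤ 2 ^ (L + 2) := by
      have := Nat.lt_two_pow_self (n := L + 2)
      rw [Finite.card_option, Finite.card_option, Nat.card_fin]
      exact this.le
    have h2 : Nat.card (Finset (Fin L)) = 2 ^ L := by simp
    rw [h2, Nat.card_fin]
    exact Nat.mul_le_mul_right _ h1
  have hcard' : (Nat.card (MergeState n b r L) : ℝ) ≤
      2 ^ (L + 2) * (β * ((ρ : ℝ) ^ L * 2 ^ L)) := by exact_mod_cast hcard
  have hpos : (0 : ℝ) < Nat.card (MergeState n b r L) := Nat.cast_pos.mpr Nat.card_pos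
  refine (Real.logb_le_logb_of_le one_lt_two hpos hcard').trans ?_
  have hβ' : (β : ℝ) ≠ 0 := Nat.cast_ne_zero.mpr hβ₀
  have hρ' : (ρ : ℝ) ≠ 0 := Nat.cast_ne_zero.mpr hρ₀
  rw [Real.logb_mul (by positivity) (by positivity), Real.logb_mul hβ' (by positivity),
    Real.logb_mul (by positivity) (by positivity), Real.logb_pow, Real.logb_pow, Real.logb_pow,
    Real.logb_self_eq_one one_lt_two]
  have hb := logb_card_small_edge_sets_le n b
  have hr := mul_le_mul_of_nonneg_left (logb_card_small_edge_sets_le n r) (Nat.cast_nonneg L)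
  push_cast
  rw [← hβ] at hb
  rw [← hρ] at hr
  linarith

/-! ### Bookkeeping that holds in every execution -/

/-- Between calls, after `a` calls and `l` edges read. The number of calls on buffer `0` is `N`. -/
structure RestInvariant (x : MergeState n b r L) (a l N : ℕ) : Prop where
  phase_ne : ∀ i, x.phase ≠ .calling i
  -- Potential argument: each call on buffer `0` brings two credits. One pays for that call, the
  -- other lies on the digit that is finally set and pays for the carry that clears it.
  calls_le : a + x.occ.card ≤ 2 * N
  -- The value of the counter. Only an inequality is kept, since setting the top digit twice would
  -- lose weight.
  weight_le : ∑ j ∈ x.occ, 2 ^ j ≤ N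
  read_le : N * b + (x.buf 0).card ≤ l
  lt_cap : 0 < L → (x.buf 0).card < b

/-- Before or during call number `a`, which is on buffer `i`. -/
structure CallInvariant (x : MergeState n b r L) (i a l N : ℕ) : Prop where
  phase_eq : x.phase = .calling i
  -- The extra `1` is the credit in transit: it is placed on a digit if the chain of carries stops
  -- here.
  calls_le : a + 1 + x.occ.card ≤ 2 * N
  weight_le : ∑ j ∈ x.occ, 2 ^ j + 2 ^ i ≤ N
  read_le : N * b ≤ l
  buf_zero : 0 < i → x.buf 0 = ∅

theorem RestInvariant.card_insert_le {x : MergeState n b r L} {a l N m : ℕ}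
    (h : x.RestInvariant a l N) (hl : l < m) (hm : L = 0 → m ≤ b) (e : Sym2 (Fin n)) :
    (insert e (x.buf 0)).card ≤ b := by
  have h1 := Finset.card_insert_le e (x.buf 0)
  rcases Nat.eq_zero_or_pos L with hL | hL
  · have := h.read_le
    have := hm hL
    omega
  · have := h.lt_cap hL
    omega

/-- A full buffer `0` turns its `b` edges into one more unit of `N`, which supplies weight `2 ^ 0`
and two credits for the call. -/
theorem RestInvariant.afterRead {x : MergeState n b r L} {a l N m : ℕ}
    (h : x.RestInvariant a l N) (hp : x.phase = .reading)
    (hl : l < m) (hm : L = 0 → m ≤ b) (e : Sym2 (Fin n)) :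
    ((x.afterRead e).phase = .reading ∧ (x.afterRead e).RestInvariant a (l + 1) N) ∨
      (x.afterRead e).CallInvariant 0 (a + 1) (l + 1) (N + 1) := by
  by_cases he : e.IsDiag
  · rw [x.afterRead_of_isDiag he]
    exact Or.inl ⟨hp, h.phase_ne, h.calls_le, h.weight_le, h.read_le.trans (Nat.le_succ l),
      h.lt_cap⟩
  have hc := h.card_insert_le hl hm e
  have hphase := phase_afterRead he hc
  have hbuf := buf_afterRead he hc
  have hins := Finset.card_insert_le e (x.buf 0)
  have h1 := h.calls_le
  have h2 := h.weight_le
  have h3 := h.read_le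
  split_ifs at hphase with hif
  · right
    refine ⟨hphase, ?_, ?_, ?_, by simp⟩
    · rw [occ_afterRead]; omega
    · rw [occ_afterRead]; simpa using h2
    · rw [Nat.succ_mul]; omega
  · left
    refine ⟨hphase, by simp [hphase], ?_, ?_, ?_, ?_⟩
    · rwa [occ_afterRead]
    · rwa [occ_afterRead]
    · rw [hbuf, Function.update_self]; omega
    · intro hL
      rw [hbuf, Function.update_self]
      rw [not_and] at hif
      exact not_le.mp (hif hL)

theorem CallInvariant.receive {x : MergeState n b r L} {i a l N : ℕ}
    (h : x.CallInvariant i a l N) (e : Sym2 (Fin n)) :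
    (x.receive e).CallInvariant i a l N := by
  refine ⟨?_, ?_, ?_, h.read_le, ?_⟩
  · rw [phase_receive, h.phase_eq]
  · rw [occ_receive]; exact h.calls_le
  · rw [occ_receive]; exact h.weight_le
  · rw [buf_zero_receive]; exact h.buf_zero

/-- In a carry, digit `i` and the pending `2 ^ i` combine to a pending `2 ^ (i + 1)`, and the erased
digit pays for the next call. -/
theorem CallInvariant.afterCall {x : MergeState n b r L} {i a l N : ℕ} (hb : 0 < b)
    (h : x.CallInvariant i a l N) :
    (x.afterCall.phase = .reading ∧ x.afterCall.RestInvariant a l N) ∨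
      (i ∈ x.occ ∧ i + 1 < L ∧ x.afterCall.CallInvariant (i + 1) (a + 1) l N) := by
  have hphase := phase_afterCall h.phase_eq
  have hocc := occ_afterCall h.phase_eq
  have h1 := h.calls_le
  have h2 := h.weight_le
  have hb0 : x.afterCall.buf 0 = ∅ := by
    rw [buf_afterCall h.phase_eq]
    rcases Nat.eq_zero_or_pos i with rfl | hi
    · simp
    · rw [Function.update_of_ne hi.ne]
      exact h.buf_zero hi
  split_ifs at hphase with hif
  · rw [if_pos hif] at hocc
    right
    have hcard := Finset.card_erase_add_one hif.1
    have hsum := Finset.sum_erase_add x.occ (fun j => 2 ^ j) hif.1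
    refine ⟨hif.1, hif.2, hphase, ?_, ?_, h.read_le, fun _ => hb0⟩
    · rw [hocc]; omega
    · rw [hocc, pow_succ]; omega
  · rw [if_neg hif] at hocc
    left
    refine ⟨hphase, by simp [hphase], ?_, ?_, ?_, ?_⟩
    · rw [hocc]
      have := Finset.card_insert_le i x.occ
      omega
    · rw [hocc]
      refine le_trans ?_ h2
      by_cases hi : i ∈ x.occ
      · rw [Finset.insert_eq_of_mem hi]; exact Nat.le_add_right _ _
      · rw [Finset.sum_insert hi, add_comm]
    · rw [hb0]; simpa using h.read_le
    · intro _; rw [hb0]; simpa using hb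

end MergeState

/-- The merge-and-reduce algorithm with buffers `0, ..., L` of capacities `b` and `r`. -/
def mergeReduce (n b r L : ℕ) : StreamAlg n where
  M := MergeState n b r L
  finiteM := inferInstance
  start := MergeState.empty
  op x :=
    match x.phase with
    | .reading => .read x.afterRead x.finish
    | .calling _ => .call
    | .halted => .halt ((Finset.range (L + 1)).biUnion x.buf)
  adj x u v :=
    match x.phase with
    | .calling i => decide (s(u, v) ∈ x.buf i)
    | _ => false
  recv x e := x.receive e
  ret x := x.afterCall

/-! ### Properties of all executions: determinism, number of calls, buffer discipline, space. -/

namespace mergeReduce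

variable {n b r L : ℕ}

theorem op_of_reading {x : MergeState n b r L} (h : x.phase = .reading) :
    (mergeReduce n b r L).op x = .read x.afterRead x.finish := by
  simp [mergeReduce, h]

theorem op_of_calling {x : MergeState n b r L} {i : ℕ} (h : x.phase = .calling i) :
    (mergeReduce n b r L).op x = .call := by
  simp [mergeReduce, h]

theorem op_of_halted {x : MergeState n b r L} (h : x.phase = .halted) :
    (mergeReduce n b r L).op x = .halt ((Finset.range (L + 1)).biUnion x.buf) := by
  simp [mergeReduce, h]

theorem adj_iff {x : MergeState n b r L} {i : ℕ} (h : x.phase = .calling i) (u v : Fin n) :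
    (mergeReduce n b r L).adj x u v = true ↔ s(u, v) ∈ x.buf i := by
  simp [mergeReduce, h]

theorem isDeterministic {S : Subroutine n} (hS : ∀ G, IsDeterministic (S.step G)) :
    IsDeterministic ((mergeReduce n b r L).step S) := by
  rintro ⟨x, q, rest, a⟩
  rcases q with _ | q
  · rcases hp : x.phase with _ | i | _
    · cases rest with
      | nil => exact ⟨_, by simp only [StreamAlg.step, op_of_reading hp]; rfl⟩
      | cons e es => exact ⟨_, by simp only [StreamAlg.step, op_of_reading hp]; rfl⟩
    · exact ⟨_, by simp only [StreamAlg.step, op_of_calling hp]; rfl⟩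
    · exact ⟨_, by simp only [StreamAlg.step, op_of_halted hp]; rfl⟩
  · cases hop : S.op q with
    | query u v no yes => exact ⟨_, by simp only [StreamAlg.step, hop]; rfl⟩
    | flip q₁ q₂ =>
      -- A deterministic subroutine may still flip a coin if both branches agree. A flip looks at
      -- neither graph nor output, so `⊥` and `∅` serve as well as any others.
      obtain ⟨c', hc'⟩ := hS ⊥ ⟨q, ∅⟩
      simp only [Subroutine.step, hop] at hc'
      have heq := eq_of_coin_eq_pure hc'
      simp only [Subroutine.Config.mk.injEq, and_true] at heq
      subst heq
      exact ⟨_, by simp only [StreamAlg.step, hop]; exact coin_self _⟩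
    | emit e q' => exact ⟨_, by simp only [StreamAlg.step, hop]; rfl⟩
    | halt => exact ⟨_, by simp only [StreamAlg.step, hop]; rfl⟩

/-- The bookkeeping invariant for configurations of the algorithm on a stream of `m` edges. -/
def Invariant (m : ℕ) (S : Subroutine n) (c : (mergeReduce n b r L).Config S) : Prop :=
  ∃ l N, l + c.rest.length = m ∧
    match c.sub with
    | none => MergeState.RestInvariant c.mem c.calls l N ∨
        ∃ i, MergeState.CallInvariant c.mem i (c.calls + 1) l N
    | some _ => ∃ i, MergeState.CallInvariant c.mem i c.calls l N

variable {S : Subroutine n} {m : ℕ}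

theorem invariant_init (hb : 0 < b) (es : List (Sym2 (Fin n))) :
    Invariant es.length S ((mergeReduce n b r L).init S es) := by
  refine ⟨0, 0, by simp [StreamAlg.init], Or.inl ?_⟩
  refine ⟨?_, ?_, ?_, ?_, fun _ => ?_⟩ <;>
    simp [StreamAlg.init, mergeReduce, MergeState.empty, hb]

theorem invariant_step (hb : 0 < b) (hm : L = 0 → m ≤ b) (c : (mergeReduce n b r L).Config S)
    (hc : Invariant m S c) :
    ∀ c' ∈ ((mergeReduce n b r L).step S c).support, Invariant m S c' := by
  obtain ⟨x, q, rest, a⟩ := c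
  obtain ⟨l, N, hl, hc⟩ := hc
  intro c' hc'
  rcases q with _ | q
  · simp only at hc hl
    rcases hc with h | ⟨i, h⟩
    · rcases hp : x.phase with _ | i | _
      · cases rest with
        | nil =>
          simp only [StreamAlg.step, op_of_reading hp, PMF.support_pure,
            Set.mem_singleton_iff] at hc'
          subst hc'
          exact ⟨l, N, hl, Or.inl ⟨by simp [MergeState.finish], h.calls_le, h.weight_le,
            h.read_le, h.lt_cap⟩⟩
        | cons e es =>
          simp only [StreamAlg.step, op_of_reading hp, PMF.support_pure,
            Set.mem_singleton_iff] at hc'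
          subst hc'
          rw [List.length_cons] at hl
          rcases h.afterRead hp (show l < m by omega) hm e with h' | h'
          · exact ⟨l + 1, N, by dsimp only; omega, Or.inl h'.2⟩
          · exact ⟨l + 1, N + 1, by dsimp only; omega, Or.inr ⟨0, h'⟩⟩
      · exact absurd hp (h.phase_ne i)
      · simp only [StreamAlg.step, op_of_halted hp, PMF.support_pure,
          Set.mem_singleton_iff] at hc'
        subst hc'
        exact ⟨l, N, hl, Or.inl h⟩
    · simp only [StreamAlg.step, op_of_calling h.phase_eq, PMF.support_pure,
        Set.mem_singleton_iff] at hc'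
      subst hc'
      exact ⟨l, N, hl, i, h⟩
  · simp only at hc hl
    obtain ⟨i, h⟩ := hc
    cases hop : S.op q with
    | query u v no yes =>
      simp only [StreamAlg.step, hop, PMF.support_pure, Set.mem_singleton_iff] at hc'
      subst hc'
      exact ⟨l, N, hl, i, h⟩
    | flip q₁ q₂ =>
      simp only [StreamAlg.step, hop] at hc'
      rcases mem_support_coin hc' with rfl | rfl <;> exact ⟨l, N, hl, i, h⟩
    | emit e q' =>
      simp only [StreamAlg.step, hop, PMF.support_pure, Set.mem_singleton_iff] at hc'
      subst hc'
      exact ⟨l, N, hl, i, h.receive e⟩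
    | halt =>
      simp only [StreamAlg.step, hop, PMF.support_pure, Set.mem_singleton_iff] at hc'
      subst hc'
      rcases h.afterCall hb with h' | h'
      · exact ⟨l, N, hl, Or.inl h'.2⟩
      · exact ⟨l, N, hl, Or.inr ⟨i + 1, h'.2.2⟩⟩

theorem invariant_of_reachable (hb : 0 < b) {es : List (Sym2 (Fin n))}
    (hm : L = 0 → es.length ≤ b) {c : (mergeReduce n b r L).Config S}
    (h : Reachable ((mergeReduce n b r L).step S) ((mergeReduce n b r L).init S es) c) :
    Invariant es.length S c :=
  h.invariant (invariant_step hb hm) (invariant_init hb es)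

/-- Every call on buffer `0` consumes `b` stream edges, so `N * b ≤ m ≤ k * b` and `N ≤ k`; the
potential then bounds the calls by `2 * N`. -/
theorem calls_le_of_invariant {k : ℕ} (hb : 0 < b) (hk : m ≤ k * b)
    {c : (mergeReduce n b r L).Config S} (h : Invariant m S c) : c.calls ≤ 2 * k := by
  obtain ⟨x, q, rest, a⟩ := c
  obtain ⟨l, N, hl, h⟩ := h
  have key : N * b ≤ l → N ≤ k := fun hN =>
    Nat.le_of_mul_le_mul_right (hN.trans (by omega)) hb
  rcases q with _ | q
  · rcases h with h | ⟨i, h⟩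
    · have := key ((Nat.le_add_right _ _).trans h.read_le)
      have := h.calls_le
      dsimp only at *
      omega
    · have := key h.read_le
      have := h.calls_le
      dsimp only at *
      omega
  · obtain ⟨i, h⟩ := h
    have := key h.read_le
    have := h.calls_le
    dsimp only at *
    omega

theorem isMergeReduce {m s : ℕ} (hb : 0 < b) (hm : L = 0 → m ≤ b) :
    (mergeReduce n b (2 * s) L).IsMergeReduce m s (L + 1) := by
  refine ⟨fun x => MergeState.buf x,
    fun x => match MergeState.phase x with | .calling i => i | _ => 0, Nat.succ_pos L,
    fun i => rfl, ?_⟩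
  intro S es hes c hc
  have hinv := invariant_of_reachable hb (fun hL => hes.trans (hm hL)) hc
  obtain ⟨x, q, rest, a⟩ := c
  obtain ⟨l, N, hl, hinv⟩ := hinv
  rcases q with _ | q
  · dsimp only at hinv hl ⊢
    rcases hp : x.phase with _ | i | _
    · rw [op_of_reading hp]
      cases rest with
      | nil => rfl
      | cons e es' =>
        dsimp only
        rcases hinv with h | ⟨i, h⟩
        · split_ifs with he
          · rw [x.afterRead_of_isDiag he]
          · rw [List.length_cons] at hl
            exact MergeState.buf_afterRead he
              (h.card_insert_le (m := es.length) (by omega) (fun hL => hes.trans (hm hL)) e)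
        · exact absurd (hp.symm.trans h.phase_eq) (by simp)
    · rw [op_of_calling hp]
      trivial
    · rw [op_of_halted hp]
  · dsimp only at hinv ⊢
    obtain ⟨i, h⟩ := hinv
    have hp := h.phase_eq
    have hlt := x.phase_lt i hp
    refine ⟨?_, ?_, ?_, ?_⟩
    · rw [hp]; dsimp only; omega
    · intro u v
      rw [hp]
      exact adj_iff hp u v
    · intro e
      have hp' : ((mergeReduce n b (2 * s) L).recv x e : MergeState n b (2 * s) L).phase =
        x.phase := MergeState.phase_receive x e
      refine ⟨by rw [hp'], ?_⟩
      rw [hp]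
      dsimp only
      by_cases hcard : (insert e (x.buf (i + 1))).card ≤ 2 * s
      · exact Or.inl (MergeState.buf_receive hp hcard)
      · right
        have hrec : (mergeReduce n b (2 * s) L).recv x e = x :=
          MergeState.receive_of_lt hp (not_le.mp hcard)
        refine ⟨by rw [hrec], ?_⟩
        have := Finset.card_insert_le e (x.buf (i + 1))
        omega
    · rw [hp]
      exact MergeState.buf_afterCall hp

/-- The idle state of the subroutine at most doubles its state count. This one extra bit is absorbed
by `X ≥ 1`. -/
theorem space_le {X : ℝ} (hX : 1 ≤ X) {c : ℝ} (hc : S.space ≤ c * X) :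
    (mergeReduce n b r L).space S ≤ Real.logb 2 (Nat.card (MergeState n b r L)) + (1 + c) * X := by
  have := S.finiteQ
  have : Nonempty S.Q := ⟨S.start⟩
  have : Nonempty (MergeState n b r L) := ⟨MergeState.empty⟩
  have hQ : (1 : ℝ) ≤ Nat.card S.Q := by exact_mod_cast Nat.card_pos
  have hM : (0 : ℝ) < Nat.card (MergeState n b r L) := by exact_mod_cast Nat.card_pos
  have hcard : (Nat.card ((mergeReduce n b r L).M × Option S.Q) : ℝ) =
      Nat.card (MergeState n b r L) * (Nat.card S.Q + 1) := by
    rw [Nat.card_prod, Finite.card_option]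
    push_cast
    rfl
  rw [StreamAlg.space, hcard, Real.logb_mul hM.ne' (by positivity)]
  have h : Real.logb 2 ((Nat.card S.Q : ℝ) + 1) ≤ 1 + S.space := by
    have h2 : Real.logb 2 (2 * (Nat.card S.Q : ℝ)) = 1 + S.space := by
      rw [Real.logb_mul two_ne_zero (by linarith), Real.logb_self_eq_one one_lt_two]
      rfl
    rw [← h2]
    exact Real.logb_le_logb_of_le one_lt_two (by linarith) (by linarith)
  linarith

end mergeReduce

/-! ### Executions in which every call succeeds -/

theorem streamGraph_append_singleton {n : ℕ} (es : List (Sym2 (Fin n))) (e : Sym2 (Fin n)) :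
    streamGraph (es ++ [e]) = SimpleGraph.fromEdgeSet ({e' | e' ∈ es} ∪ {e}) := by
  rw [streamGraph]
  congr 1
  ext e'
  simp [or_comm]

namespace MergeState

variable {n b r L : ℕ}

/-- The buffers form a `D`-cover of the edges `es` read so far, and each of them, except for
buffer `0` and the one that is to be reduced next, holds at most one output of a call. -/
structure Good (x : MergeState n b r L) (s i : ℕ) (es : List (Sym2 (Fin n))) (D : ℝ) : Prop where
  cover : IsMatchingCover D (streamGraph es) ((Finset.range (L + 1)).biUnion x.buf)
  card_le : ∀ j, j + 1 ≠ i → (x.buf (j + 1)).card ≤ if j ∈ x.occ then s else 0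

variable {x : MergeState n b r L} {s i : ℕ} {es : List (Sym2 (Fin n))} {D : ℝ}

theorem Good.not_isDiag (h : x.Good s i es D) {j : ℕ} {e : Sym2 (Fin n)} (he : e ∈ x.buf j) :
    ¬ e.IsDiag := by
  refine h.cover.not_isDiag (Finset.mem_biUnion.mpr ⟨j, Finset.mem_range.mpr ?_, he⟩)
  by_contra hj
  rw [x.buf_eq j (by omega)] at he
  simp at he

/-- A new edge is a cover of itself with loss `0`, and self-loops do not change the streamed graph.
-/
theorem Good.afterRead (h : x.Good s 0 es D) {e : Sym2 (Fin n)}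
    (hc : (insert e (x.buf 0)).card ≤ b) : (x.afterRead e).Good s 0 (es ++ [e]) D := by
  by_cases he : e.IsDiag
  · rw [x.afterRead_of_isDiag he]
    refine ⟨?_, h.card_le⟩
    have hg : streamGraph (es ++ [e]) = streamGraph es := by
      rw [streamGraph_append_singleton, streamGraph]
      ext u v
      simp only [SimpleGraph.fromEdgeSet_adj, Set.mem_union, Set.mem_ofPred_eq,
        Set.mem_singleton_iff]
      constructor
      · rintro ⟨h | rfl, huv⟩
        · exact ⟨h, huv⟩
        · exact absurd (Sym2.mk_isDiag_iff.mp he) huv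
      · rintro ⟨h, huv⟩
        exact ⟨Or.inl h, huv⟩
    rw [hg]
    exact h.cover
  have hbuf := buf_afterRead he hc
  constructor
  · have hU : (Finset.range (L + 1)).biUnion (x.afterRead e).buf =
        (Finset.range (L + 1)).biUnion x.buf ∪ {e} := by
      rw [hbuf]
      ext f
      simp only [Finset.mem_biUnion, Finset.mem_union, Finset.mem_range, Finset.mem_singleton]
      constructor
      · rintro ⟨j, hj, hf⟩
        rcases eq_or_ne j 0 with rfl | hj0
        · rw [Function.update_self, Finset.mem_insert] at hf
          rcases hf with hf | hf
          · exact Or.inr hf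
          · exact Or.inl ⟨0, hj, hf⟩
        · rw [Function.update_of_ne hj0] at hf
          exact Or.inl ⟨j, hj, hf⟩
      · rintro (⟨j, hj, hf⟩ | rfl)
        · refine ⟨j, hj, ?_⟩
          rcases eq_or_ne j 0 with rfl | hj0
          · rw [Function.update_self]
            exact Finset.mem_insert_of_mem hf
          · rwa [Function.update_of_ne hj0]
        · exact ⟨0, Nat.succ_pos L, by rw [Function.update_self]; exact Finset.mem_insert_self _ _⟩
    rw [hU, streamGraph_append_singleton, ← add_zero D]
    refine h.cover.union ?_
    have := IsMatchingCover.refl (F := {e}) (by simpa using he)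
    rwa [Finset.coe_singleton] at this
  · intro j hj
    rw [hbuf, occ_afterRead, Function.update_of_ne hj]
    exact h.card_le j hj

/-- A successful call: `y` is the memory after the edges `o` have been received. -/
theorem Good.afterCall {y : MergeState n b r L} {δ : ℝ} {o : Finset (Sym2 (Fin n))} {a l N : ℕ}
    (h : x.Good s i es D) (hy : y.CallInvariant i a l N) (hocc : y.occ = x.occ)
    (hbuf : y.buf = Function.update x.buf (i + 1) (x.buf (i + 1) ∪ o))
    (ho : IsMatchingCover δ
      (SimpleGraph.fromEdgeSet ((x.buf i : Finset (Sym2 (Fin n))) : Set (Sym2 (Fin n)))) o)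
    (hos : o.card ≤ s) (hN : s = 0 ∨ N < 2 ^ L) :
    y.afterCall.Good s (if i ∈ x.occ ∧ i + 1 < L then i + 1 else 0) es (D + δ) := by
  have hiL := y.phase_lt i hy.phase_eq
  have hbuf' := buf_afterCall hy.phase_eq
  have hocc' := occ_afterCall hy.phase_eq
  have hself : y.afterCall.buf i = ∅ := by rw [hbuf', Function.update_self]
  have hnext : y.afterCall.buf (i + 1) = x.buf (i + 1) ∪ o := by
    rw [hbuf', Function.update_of_ne (by omega), hbuf, Function.update_self]
  have hother : ∀ j, j ≠ i → j ≠ i + 1 → y.afterCall.buf j = x.buf j := by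
    intro j h1 h2
    rw [hbuf', Function.update_of_ne h1, hbuf, Function.update_of_ne h2]
  constructor
  -- `V` collects all buffers but the reduced one. The call replaces `V ∪ x.buf i` by `V ∪ o`, which
  -- is a `δ`-cover of it.
  · set V := ((Finset.range (L + 1)).erase i).biUnion x.buf with hV
    have hVx : (Finset.range (L + 1)).biUnion x.buf = V ∪ x.buf i := by
      rw [hV, Finset.union_comm, ← Finset.biUnion_insert,
        Finset.insert_erase (Finset.mem_range.mpr (by omega))]
    have hVy : (Finset.range (L + 1)).biUnion y.afterCall.buf = V ∪ o := by
      ext f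
      simp only [hV, Finset.mem_biUnion, Finset.mem_union, Finset.mem_erase, Finset.mem_range]
      constructor
      · rintro ⟨j, hj, hf⟩
        rcases eq_or_ne j i with rfl | hji
        · simp [hself] at hf
        rcases eq_or_ne j (i + 1) with rfl | hji'
        · rw [hnext, Finset.mem_union] at hf
          exact hf.imp_left fun hf => ⟨_, ⟨hji, hj⟩, hf⟩
        · rw [hother j hji hji'] at hf
          exact Or.inl ⟨j, ⟨hji, hj⟩, hf⟩
      · rintro (⟨j, ⟨hji, hj⟩, hf⟩ | hf)
        · refine ⟨j, hj, ?_⟩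
          rcases eq_or_ne j (i + 1) with rfl | hji'
          · rw [hnext]
            exact Finset.mem_union_left _ hf
          · rwa [hother j hji hji']
        · exact ⟨i + 1, by omega, by rw [hnext]; exact Finset.mem_union_right _ hf⟩
    rw [hVy]
    refine h.cover.trans ?_
    rw [hVx, Finset.coe_union, ← zero_add δ]
    refine (IsMatchingCover.refl fun e he => ?_).union ho
    exact h.cover.not_isDiag (by rw [hVx]; exact Finset.mem_union_left _ he)
  · intro j hj
    rcases eq_or_ne (j + 1) i with hji | hji
    · rw [hji, hself]
      simp
    have hsize := h.card_le j hji
    rw [hocc', hocc]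
    rw [hocc] at hocc'
    rcases eq_or_ne j i with rfl | hne
    · rw [hnext]
      have hun := Finset.card_union_le (x.buf (j + 1)) o
      by_cases hif : j ∈ x.occ ∧ j + 1 < L
      · rw [if_pos hif] at hj
        exact absurd rfl hj
      rw [if_neg hif, if_pos (Finset.mem_insert_self _ _)]
      by_cases hjo : j ∈ x.occ
      · rw [if_pos hjo] at hsize
        -- A second output stays in buffer `j + 1` only at the top level `j + 1 = L`. Then digit `j`
        -- and the pending call weigh `2 ^ L` together, against `N < 2 ^ L`; for `s = 0` the output
        -- is empty anyway.
        rcases hN with rfl | hN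
        · omega
        · exfalso
          have hL : L = j + 1 := by
            rw [not_and] at hif
            have := hif hjo
            omega
          have hw := hy.weight_le
          have hle := Finset.single_le_sum (f := fun j => 2 ^ j) (fun _ _ => Nat.zero_le _)
            (hocc ▸ hjo)
          rw [hL, pow_succ] at hN
          omega
      · rw [if_neg hjo] at hsize
        omega
    · rw [hother (j + 1) hji (by omega)]
      refine hsize.trans ?_
      split_ifs <;> simp_all
end MergeState

/-! ### Success probability of the whole algorithm. -/

namespace mergeReduce

variable {n b s L k : ℕ} {S : Subroutine n} {es : List (Sym2 (Fin n))} {α δ : ℝ}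

/-- The successful final configurations. -/
def successSet (b r L : ℕ) (S : Subroutine n) (es : List (Sym2 (Fin n))) (α : ℝ) :
    Set ((mergeReduce n b r L).Config S) :=
  {c | c.sub = none ∧ ∃ F, (mergeReduce n b r L).op c.mem = .halt F ∧
    IsMatchingCover α (streamGraph es) F}

theorem step_of_mem_successSet {r : ℕ} {c : (mergeReduce n b r L).Config S}
    (hc : c ∈ successSet b r L S es α) : (mergeReduce n b r L).step S c = PMF.pure c := by
  obtain ⟨hsub, F, hop, -⟩ := hc
  simp [StreamAlg.step, hsub, hop]

variable {θ : ℝ≥0∞}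

/-- The success probability before a call, given bounds for the configurations in which the next
edge of the stream is read. -/
theorem pow_le_haltProb_of_calling (hb : 0 < b) (hk : es.length ≤ k * b)
    (hL : s = 0 ∨ L = 0 ∨ k < 2 ^ L)
    (hθ : ∀ G : SimpleGraph (Fin n), G.edgeSet.ncard ≤ max b (2 * s) →
      θ ≤ haltProb (S.step G) ⟨S.start, ∅⟩
        {c | S.op c.mem = .halt ∧ IsMatchingCover δ G c.out ∧ c.out.card ≤ s})
    {pre rest : List (Sym2 (Fin n))} (hes : pre.length + rest.length = es.length)
    (hrest : ∀ (x : MergeState n b (2 * s) L) (a N : ℕ), x.RestInvariant a pre.length N →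
      x.phase = .reading → x.Good s 0 pre (a * δ) →
      θ ^ (2 * k - a) ≤ haltProb ((mergeReduce n b (2 * s) L).step S) ⟨x, none, rest, a⟩
        (successSet b (2 * s) L S es α))
    (d i : ℕ) (hd : L - i ≤ d) (x : MergeState n b (2 * s) L) (a N : ℕ)
    (hx : x.CallInvariant i (a + 1) pre.length N) (hg : x.Good s i pre (a * δ)) :
    θ ^ (2 * k - a) ≤ haltProb ((mergeReduce n b (2 * s) L).step S) ⟨x, none, rest, a⟩
      (successSet b (2 * s) L S es α) := by
  -- The induction runs along the chain of carries, each one level higher; `hrest` takes over when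
  -- the chain stops.
  induction d generalizing i x a with
  | zero =>
    have := x.phase_lt i hx.phase_eq
    omega
  | succ d ih =>
    have hiL := x.phase_lt i hx.phase_eq
    have hNk : N ≤ k := Nat.le_of_mul_le_mul_right (hx.read_le.trans (by omega)) hb
    -- The subtraction is not truncated because `calls_le` leaves room for call number `a + 1`; this
    -- call uses up one factor `θ`.
    have ha : 2 * k - a = 2 * k - (a + 1) + 1 := by
      have := hx.calls_le
      omega
    refine le_trans ?_ (haltProb_of_pure (c' := ⟨x, some S.start, rest, a + 1⟩)
      (by simp only [StreamAlg.step, op_of_calling hx.phase_eq]) _)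
    rw [ha, pow_succ']
    set G := SimpleGraph.fromEdgeSet
      ((x.buf i : Finset (Sym2 (Fin n))) : Set (Sym2 (Fin n))) with hG
    have hGcard : G.edgeSet.ncard ≤ max b (2 * s) := by
      rw [hG, SimpleGraph.edgeSet_fromEdgeSet]
      refine (Set.ncard_le_ncard Set.sdiff_subset).trans ?_
      rw [Set.ncard_coe_finset]
      rcases i with _ | i
      · exact le_max_of_le_left x.card_zero
      · exact le_max_of_le_right (x.card_succ i)
    refine (mul_le_mul_left (hθ G hGcard) _).trans ?_
    refine StreamAlg.haltProb_call (A := mergeReduce n b (2 * s) L)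
      (fun c hc => step_of_mem_successSet hc) (P := fun o => IsMatchingCover δ G o)
      (R := fun o (y : MergeState n b (2 * s) L) => y.phase = .calling i ∧ y.occ = x.occ ∧
        y.buf = Function.update x.buf (i + 1) (x.buf (i + 1) ∪ o)) ?_ ?_ ?_ ?_
    · rintro o y ⟨hp, -, hbuf⟩ u v
      rw [adj_iff hp, hbuf, Function.update_of_ne (by omega), hG, SimpleGraph.fromEdgeSet_adj,
        Finset.mem_coe]
      exact ⟨fun h => ⟨h, fun huv => hg.not_isDiag h (Sym2.mk_isDiag_iff.mpr huv)⟩, fun h => h.1⟩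
    · rintro o y e ⟨hp, hocc, hbuf⟩ hcard
      have hyb : y.buf (i + 1) = x.buf (i + 1) ∪ o := by rw [hbuf, Function.update_self]
      have hle : (insert e (y.buf (i + 1))).card ≤ 2 * s := by
        rw [hyb, ← Finset.union_insert]
        have h1 := Finset.card_union_le (x.buf (i + 1)) (insert e o)
        -- The receiving buffer held at most `s` edges before the call and at most `s` are written,
        -- so the capacity `2 * s` is never exceeded.
        have h2 := hg.card_le i (by omega)
        split_ifs at h2 <;> omega
      refine ⟨(MergeState.phase_receive y e).trans hp, (MergeState.occ_receive y e).trans hocc,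
        (MergeState.buf_receive hp hle).trans ?_⟩
      rw [hyb, hbuf, Function.update_idem, Finset.union_insert]
    · rintro o y ⟨hp, hocc, hbuf⟩ hcov hcard
      have hy : y.CallInvariant i (a + 1) pre.length N := by
        refine ⟨hp, by rw [hocc]; exact hx.calls_le, by rw [hocc]; exact hx.weight_le,
          hx.read_le, fun hi => ?_⟩
        rw [hbuf, Function.update_of_ne (by omega)]
        exact hx.buf_zero hi
      have hgood := hg.afterCall hy hocc hbuf hcov hcard (by
        rcases hL with h | h | h
        · exact Or.inl h
        · omega
        · exact Or.inr (hNk.trans_lt h))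
      have hD : (a : ℝ) * δ + δ = ((a + 1 : ℕ) : ℝ) * δ := by
        push_cast
        ring
      rw [hD] at hgood
      rcases hy.afterCall hb with ⟨hread, hinv⟩ | ⟨hi, hi', hinv⟩
      · refine hrest y.afterCall (a + 1) N hinv hread ?_
        rwa [if_neg] at hgood
        intro hif
        rw [MergeState.phase_afterCall hp, hocc, if_pos hif] at hread
        simp at hread
      · rw [if_pos ⟨hocc ▸ hi, hi'⟩] at hgood
        exact ih (i + 1) (by omega) y.afterCall (a + 1) hinv hgood
    · refine ⟨hx.phase_eq, rfl, ?_⟩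
      rw [Finset.union_empty, Function.update_eq_self]

/-- Induction on the unread stream: after `a` calls the loss is `a * δ`, and at most `2 * k - a`
calls, each contributing a factor `θ`, are still to come. -/
theorem pow_le_haltProb_of_reading (hb : 0 < b) (hk : es.length ≤ k * b)
    (hm : L = 0 → es.length ≤ b) (hL : s = 0 ∨ L = 0 ∨ k < 2 ^ L)
    (hδ : 0 ≤ δ) (hα : ((2 * k : ℕ) : ℝ) * δ ≤ α) (hθ₁ : θ ≤ 1)
    (hθ : ∀ G : SimpleGraph (Fin n), G.edgeSet.ncard ≤ max b (2 * s) →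
      θ ≤ haltProb (S.step G) ⟨S.start, ∅⟩
        {c | S.op c.mem = .halt ∧ IsMatchingCover δ G c.out ∧ c.out.card ≤ s})
    (rest pre : List (Sym2 (Fin n))) (hes : pre ++ rest = es)
    (x : MergeState n b (2 * s) L) (a N : ℕ) (hx : x.RestInvariant a pre.length N)
    (hp : x.phase = .reading) (hg : x.Good s 0 pre (a * δ)) :
    θ ^ (2 * k - a) ≤ haltProb ((mergeReduce n b (2 * s) L).step S) ⟨x, none, rest, a⟩
      (successSet b (2 * s) L S es α) := by
  induction rest generalizing pre x a N with
  | nil =>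
    rw [List.append_nil] at hes
    subst hes
    refine le_trans (pow_le_one₀ zero_le hθ₁) ?_
    refine le_trans ?_ (haltProb_of_pure (c' := ⟨x.finish, none, [], a⟩)
      (by simp only [StreamAlg.step, op_of_reading hp]) _)
    refine haltProb_of_mem ⟨rfl, _, op_of_halted rfl, hg.cover.mono (le_trans ?_ hα)⟩
    have hNk : N ≤ k := Nat.le_of_mul_le_mul_right
      (((Nat.le_add_right _ _).trans hx.read_le).trans hk) hb
    have ha : a ≤ 2 * k := by
      have := hx.calls_le
      omega
    exact mul_le_mul_of_nonneg_right (Nat.cast_le.mpr ha) hδ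
  | cons e rest ih =>
    have hes' : (pre ++ [e]) ++ rest = es := by simpa using hes
    have hlen := congrArg List.length hes'
    simp only [List.length_append, List.length_singleton] at hlen
    have hlt : pre.length < es.length := by omega
    have hgood := hg.afterRead (hx.card_insert_le hlt hm e)
    refine le_trans ?_ (haltProb_of_pure (c' := ⟨x.afterRead e, none, rest, a⟩)
      (by simp only [StreamAlg.step, op_of_reading hp]) _)
    have hl : (pre ++ [e]).length = pre.length + 1 := by simp
    rcases hx.afterRead hp hlt hm e with ⟨hread, h⟩ | h
    · exact ih (pre ++ [e]) hes' _ a N (by rwa [hl]) hread hgood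
    · exact pow_le_haltProb_of_calling hb hk hL hθ (pre := pre ++ [e]) (by rw [hl]; omega)
        (fun y a' N' hy hyp hyg => ih (pre ++ [e]) hes' y a' N' hy hyp hyg)
        L 0 (by omega) _ a (N + 1) (by rwa [hl]) hgood

theorem le_successProb {p : ℝ} (hp : 0 ≤ p) (hb : 0 < b) (hk₀ : 1 ≤ k)
    (hk : es.length ≤ k * b) (hm : L = 0 → es.length ≤ b) (hL : s = 0 ∨ L = 0 ∨ k < 2 ^ L)
    (hδ : 0 ≤ δ) (hα : ((2 * k : ℕ) : ℝ) * δ ≤ α)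
    (hS : S.ComputesCovers (max b (2 * s)) δ s p) :
    ENNReal.ofReal (1 - 2 * k * p) ≤ (mergeReduce n b (2 * s) L).successProb S es α := by
  have hθ₁ : ENNReal.ofReal (1 - p) ≤ 1 := ENNReal.ofReal_le_one.mpr (by linarith)
  have hg : (MergeState.empty : MergeState n b (2 * s) L).Good s 0 [] (((0 : ℕ) : ℝ) * δ) := by
    constructor
    · rw [Nat.cast_zero, zero_mul]
      have := IsMatchingCover.refl (n := n) (F := ∅) (by simp)
      have hU : (Finset.range (L + 1)).biUnion (MergeState.empty : MergeState n b (2 * s) L).buf =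
          ∅ := by
        ext f
        simp [MergeState.empty]
      rw [hU]
      simpa [streamGraph] using this
    · intro j _
      simp [MergeState.empty]
  have h := pow_le_haltProb_of_reading (n := n) (es := es) hb hk hm hL hδ hα hθ₁ hS es [] rfl
    MergeState.empty 0 0
    (by refine ⟨?_, ?_, ?_, ?_, fun _ => ?_⟩ <;> simp [MergeState.empty, hb]) rfl hg
  refine le_trans ?_ h
  -- For `p ≤ 1` this is Bernoulli's inequality; for `p > 1` the claimed bound is not positive.
  rcases le_or_gt p 1 with hp₁ | hp₁
  · rw [← ENNReal.ofReal_pow (by linarith)]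
    refine ENNReal.ofReal_le_ofReal ?_
    have := one_add_mul_le_pow (a := -p) (by linarith) (2 * k - 0)
    rw [Nat.sub_zero] at this ⊢
    push_cast at this
    rw [← sub_eq_add_neg] at this
    linarith
  · have hk₁ : (1 : ℝ) ≤ k := by exact_mod_cast hk₀
    rw [ENNReal.ofReal_of_nonpos (by nlinarith)]
    exact zero_le

end mergeReduce

/-! ### Choice of the number of levels, and the resulting space bound. -/

/-- The number of buffers besides buffer `0`. If `s = 0` then one is enough, as it stays empty. -/
def numLevels (k s : ℕ) : ℕ :=
  if k = 1 then 0 else if s = 0 then 1 else 1 + Nat.log 2 k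

theorem numLevels_spec (k s : ℕ) :
    (numLevels k s = 0 → k = 1) ∧
      (s = 0 ∨ numLevels k s = 0 ∨ k < 2 ^ numLevels k s) := by
  rw [numLevels]
  split_ifs with h1 h2
  · exact ⟨fun _ => h1, Or.inr (Or.inl rfl)⟩
  · exact ⟨by simp, Or.inl h2⟩
  · refine ⟨by omega, Or.inr (Or.inr ?_)⟩
    rw [add_comm]
    exact Nat.lt_pow_succ_log_self one_lt_two k

/-- These are the regimes of the space bound. The term with `s` vanishes for `k = 1` and for `s =
0`, so there even the bookkeeping of `log k` levels would not be paid for; otherwise `log k ≥ 1` and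
`s ≥ 1` absorb additive constants. -/
theorem numLevels_cases {k : ℕ} (s : ℕ) (hk : 1 ≤ k) :
    numLevels k s = 0 ∨ (s = 0 ∧ numLevels k s = 1 ∧ 1 ≤ Real.logb 2 k) ∨
      (1 ≤ s ∧ (numLevels k s : ℝ) ≤ 1 + Real.logb 2 k ∧ 1 ≤ Real.logb 2 k) := by
  have hlog : k ≠ 1 → 1 ≤ Real.logb 2 k := by
    intro h
    rw [Real.le_logb_iff_rpow_le one_lt_two (by exact_mod_cast hk), Real.rpow_one]
    exact_mod_cast (show 2 ≤ k by omega)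
  rw [numLevels]
  split_ifs with h1 h2
  · exact Or.inl rfl
  · exact Or.inr (Or.inl ⟨h2, rfl, hlog h1⟩)
  · refine Or.inr (Or.inr ⟨by omega, ?_, hlog h1⟩)
    push_cast
    have := Real.natLog_le_logb k 2
    push_cast at this
    linarith

theorem logb_card_mergeState_le {n m k s : ℕ} (hk : 1 ≤ k) (hkm : k ≤ m) :
    Real.logb 2 (Nat.card (MergeState n ⌈(m : ℝ) / k⌉₊ (2 * s) (numLevels k s))) ≤
      14 * ((m : ℝ) / k * log₂ ((n : ℝ) ^ 2 * k / m) +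
        s * log₂ ((n : ℝ) ^ 2 / s) * Real.logb 2 k) := by
  have hk₁ : (1 : ℝ) ≤ k := by exact_mod_cast hk
  have hkm' : (k : ℝ) ≤ m := by exact_mod_cast hkm
  have hm₀ : (0 : ℝ) < m := by linarith
  have hq : (1 : ℝ) ≤ (m : ℝ) / k := (one_le_div (by linarith)).mpr hkm'
  set b := ⌈(m : ℝ) / k⌉₊ with hb
  set L := numLevels k s with hLdef
  have hb₁ : (m : ℝ) / k ≤ b := Nat.le_ceil _
  have hb₂ : (b : ℝ) ≤ 2 * ((m : ℝ) / k) := by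
    have := Nat.ceil_lt_add_one (show (0 : ℝ) ≤ (m : ℝ) / k by linarith)
    linarith
  set X := (m : ℝ) / k * log₂ ((n : ℝ) ^ 2 * k / m) with hX
  set Y := (s : ℝ) * log₂ ((n : ℝ) ^ 2 / s) with hY
  have hX₁ : 1 ≤ X := by nlinarith [one_le_log₂ ((n : ℝ) ^ 2 * k / m)]
  have hbX : (b : ℝ) * log₂ ((n : ℝ) ^ 2 / b) ≤ 2 * X := by
    have hlog : log₂ ((n : ℝ) ^ 2 / b) ≤ log₂ ((n : ℝ) ^ 2 * k / m) := by
      rcases Nat.eq_zero_or_pos n with rfl | hn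
      · simp
      · have hn' : (0 : ℝ) < n := Nat.cast_pos.mpr hn
        refine log₂_mono (div_pos (by positivity) (by linarith)) ?_
        rw [← div_div_eq_mul_div]
        exact div_le_div_of_nonneg_left (by positivity) (by linarith) hb₁
    calc (b : ℝ) * log₂ ((n : ℝ) ^ 2 / b)
        ≤ 2 * ((m : ℝ) / k) * log₂ ((n : ℝ) ^ 2 * k / m) :=
          mul_le_mul hb₂ hlog (by linarith [one_le_log₂ ((n : ℝ) ^ 2 / b)]) (by linarith)
      _ = 2 * X := by rw [hX]; ring
  have hsY : ((2 * s : ℕ) : ℝ) * log₂ ((n : ℝ) ^ 2 / ((2 * s : ℕ) : ℝ)) ≤ 2 * Y := by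
    push_cast
    rcases Nat.eq_zero_or_pos s with rfl | hs
    · simp [hY]
    have hs' : (0 : ℝ) < s := Nat.cast_pos.mpr hs
    have hlog : log₂ ((n : ℝ) ^ 2 / (2 * s)) ≤ log₂ ((n : ℝ) ^ 2 / s) := by
      rcases Nat.eq_zero_or_pos n with rfl | hn
      · simp
      · have hn' : (0 : ℝ) < n := Nat.cast_pos.mpr hn
        exact log₂_mono (by positivity)
          (div_le_div_of_nonneg_left (by positivity) hs' (by linarith))
    rw [hY]
    nlinarith
  have h := MergeState.logb_card_le (n := n) (b := b) (r := 2 * s) (L := L)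
  refine h.trans ?_
  have hL₀ : (0 : ℝ) ≤ L := Nat.cast_nonneg L
  have hLY : (L : ℝ) * (5 / 2 * (((2 * s : ℕ) : ℝ) * log₂ ((n : ℝ) ^ 2 / ((2 * s : ℕ) : ℝ))) + 1) ≤
      L * (5 * Y + 1) := mul_le_mul_of_nonneg_left (by linarith) hL₀
  rcases numLevels_cases s hk with h0 | ⟨hs, h1, hK⟩ | ⟨hs, h1, hK⟩
  · rw [← hLdef] at h0
    have hK : 0 ≤ Real.logb 2 k := Real.logb_nonneg one_lt_two hk₁
    have hY₀ : 0 ≤ Y := mul_nonneg (Nat.cast_nonneg s) (by linarith [one_le_log₂ ((n : ℝ) ^ 2 / s)])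
    have := mul_nonneg hY₀ hK
    rw [h0] at hLY ⊢
    push_cast at hLY ⊢
    linarith
  · rw [← hLdef] at h1
    have hY₀ : Y = 0 := by rw [hY, hs]; simp
    rw [h1, hY₀] at hLY
    rw [h1, hY₀]
    push_cast at hLY ⊢
    linarith
  · rw [← hLdef] at h1
    have hs₁ : (1 : ℝ) ≤ s := by exact_mod_cast hs
    have hY₁ : 1 ≤ Y := by nlinarith [one_le_log₂ ((n : ℝ) ^ 2 / s)]
    have hL₂ : (L : ℝ) ≤ 2 * Real.logb 2 k := by linarith
    have hKY : Real.logb 2 k ≤ Y * Real.logb 2 k := by nlinarith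
    -- These levels cost `12 * Y * log k`; the additional `L ≤ 2 * log k` bits are at most `2 * Y *
    -- log k`, which explains the constant `14`.
    have h3 : (L : ℝ) * (5 * Y + 1) ≤ 2 * Real.logb 2 k * (6 * Y) :=
      mul_le_mul hL₂ (by linarith) (by linarith) (by linarith)
    linarith

theorem mainTheorem6 (c : ℝ) (hc : 0 < c) :
    ∃ C : ℝ, 0 < C ∧
      ∀ (n m k s : ℕ) (α : ℝ), 1 ≤ k → k ≤ m → 0 < α → α < 1 / 10 →
        ∃ (A : StreamAlg n) (t : ℕ),
          A.IsMergeReduce m s t ∧ (t : ℝ) ≤ C * (1 + Real.logb 2 k) ∧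
          ∀ (S : Subroutine n) (p : ℝ), 0 ≤ p →
            S.space ≤ c * ((m : ℝ) / k * log₂ ((n : ℝ) ^ 2 * k / m)) →
            S.ComputesCovers (max ⌈(m : ℝ) / k⌉₊ (2 * s)) (α / (2 * k)) s p →
              A.space S ≤ C * ((m : ℝ) / k * log₂ ((n : ℝ) ^ 2 * k / m) +
                s * log₂ ((n : ℝ) ^ 2 / s) * Real.logb 2 k) ∧
              (∀ es : List (Sym2 (Fin n)), es.length ≤ m →
                ENNReal.ofReal (1 - C * k * p) ≤ A.successProb S es α ∧
                ∀ c', Reachable (A.step S) (A.init S es) c' → (c'.calls : ℝ) ≤ C * k) ∧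
              ((∀ G, IsDeterministic (S.step G)) → IsDeterministic (A.step S)) := by
  -- The buffers need `14`, and running the subroutine needs `1 + c`; the number of calls and the
  -- failure probability need only `2`.
  refine ⟨15 + c, by linarith, ?_⟩
  intro n m k s α hk hkm hα₀ _
  have hk₁ : (1 : ℝ) ≤ k := by exact_mod_cast hk
  have hkm' : (k : ℝ) ≤ m := by exact_mod_cast hkm
  have hk₀ : (0 : ℝ) < k := by linarith
  have hq : (1 : ℝ) ≤ (m : ℝ) / k := (one_le_div hk₀).mpr hkm'
  have hb : 0 < ⌈(m : ℝ) / k⌉₊ := Nat.ceil_pos.mpr (by linarith)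
  have hmb : m ≤ k * ⌈(m : ℝ) / k⌉₊ := by
    have h := mul_le_mul_of_nonneg_left (Nat.le_ceil ((m : ℝ) / k)) hk₀.le
    rw [mul_div_cancel₀ _ hk₀.ne'] at h
    exact_mod_cast h
  obtain ⟨hL₀, hL⟩ := numLevels_spec k s
  have hm : numLevels k s = 0 → m ≤ ⌈(m : ℝ) / k⌉₊ := by
    intro h
    have h1 := hL₀ h
    rw [h1, one_mul] at hmb
    rwa [h1]
  have hK : 0 ≤ Real.logb 2 k := Real.logb_nonneg one_lt_two hk₁
  refine ⟨mergeReduce n ⌈(m : ℝ) / k⌉₊ (2 * s) (numLevels k s), numLevels k s + 1,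
    mergeReduce.isMergeReduce hb hm, ?_, ?_⟩
  · push_cast
    have hle : (numLevels k s : ℝ) ≤ 1 + Real.logb 2 k := by
      rcases numLevels_cases s hk with h | ⟨-, h, -⟩ | ⟨-, h, -⟩
      · rw [h]; push_cast; linarith
      · rw [h]; push_cast; linarith
      · exact h
    nlinarith
  intro S p hp hspace hS
  refine ⟨?_, fun es hes => ⟨?_, fun c' hc' => ?_⟩, mergeReduce.isDeterministic⟩
  · have hX : 1 ≤ (m : ℝ) / k * log₂ ((n : ℝ) ^ 2 * k / m) := by
      nlinarith [one_le_log₂ ((n : ℝ) ^ 2 * k / m)]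
    have h₁ := mergeReduce.space_le (b := ⌈(m : ℝ) / k⌉₊) (r := 2 * s) (L := numLevels k s)
      hX hspace
    have h₂ := logb_card_mergeState_le (n := n) (s := s) hk hkm
    have h₃ : 0 ≤ (s : ℝ) * log₂ ((n : ℝ) ^ 2 / s) * Real.logb 2 k :=
      mul_nonneg (mul_nonneg (Nat.cast_nonneg s)
        (by linarith [one_le_log₂ ((n : ℝ) ^ 2 / s)])) hK
    nlinarith [mul_nonneg hc.le h₃]
  · refine le_trans (ENNReal.ofReal_le_ofReal ?_) (mergeReduce.le_successProb
      (δ := α / (2 * k)) hp hb hk (hes.trans hmb) (fun h => hes.trans (hm h)) hL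
      (by positivity) ?_ hS)
    · have := mul_nonneg hk₀.le hp
      nlinarith
    · push_cast
      rw [mul_div_cancel₀ _ (by positivity)]
  · have hinv := mergeReduce.invariant_of_reachable hb (fun h => hes.trans (hm h)) hc'
    have hcalls := mergeReduce.calls_le_of_invariant hb (hes.trans hmb) hinv
    have hcalls' : (c'.calls : ℝ) ≤ 2 * k := by exact_mod_cast hcalls
    nlinarith
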